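/- Let $(\Omega,\mathcal A)$ be a measurable space. For each $n$ let $\mathbb P_n$ be a probability measure on $(\Omega,\mathcal A)$, let $\mathcal F_n\subseteq\mathcal A$ be a $\sigma$-algebra, and let $W_{1n},\dots,W_{nn}$ be real random variables on $(\Omega,\mathcal A)$ that are independent conditionally on $\mathcal F_n$ under $\mathbb P_n$. For $[0,\infty]$-valued random variables $X_n$, write $X_n=O_{\mathbb P_n}(1)$ if for each $\delta>0$ there is $M>0$ with $\limsup_{n\to\infty}\mathbb P_n[X_n>M]<\delta$, and $X_n=\Omega_{\mathbb P_n}(1)$ if for each $\delta>0$ there is $\eta>0$ with $\limsup_{n\to\infty}\mathbb P_n[X_n<\eta]<\delta$. All conditional probabilities and moments given $\mathcal F_n$ are taken under $\mathbb P_n$ with respect to regular conditional distributions given $\mathcal F_n$; conditional variances and third absolute central moments take values in $[0,\infty]$ (and the conditional mean is set to $0$ where the conditional distribution has no finite mean). Suppose that $$S_n^2:=\frac1n\sum_{i=1}^n\operatorname{Var}_{\mathbb P_n}[W_{in}\mid\mathcal F_n]=\Omega_{\mathbb P_n}(1)$$ and $$\frac1n\sum_{i=1}^n\mathbb E_{\mathbb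 P_n}\bigl[|W_{in}-\mathbb E_{\mathbb P_n}[W_{in}\mid\mathcal F_n]|^3\mid\mathcal F_n\bigr]=O_{\mathbb P_n}(1).$$ Then $$\sqrt n\,\sup_{t\in\mathbb R}\left|\mathbb P_n\left[\sqrt{\frac{n}{S_n^2}}\;\frac1n\sum_{i=1}^n\bigl(W_{in}-\mathbb E_{\mathbb P_n}[W_{in}\mid\mathcal F_n]\bigr)\le t\;\middle|\;\mathcal F_n\right]-\Phi(t)\right|=O_{\mathbb P_n}(1),$$ where $\Phi$ is the standard normal distribution function, and the standardized sum is set to $0$ where $S_n^2\in\{0,\infty\}$. -/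

import Mathlib

open MeasureTheory ProbabilityTheory Filter
open scoped ENNReal NNReal

/-- `W_n = O_{P_n}(1)`, for `[0,∞]`-valued `W_n`: for each `δ > 0` there is an `M > 0` such that
`limsup_n P_n[W_n > M] < δ`. -/
def IsBigOInProb {Ω : Type*} [MeasurableSpace Ω] (P : ℕ → Measure Ω) (W : ℕ → Ω → ℝ≥0∞) : Prop :=
  ∀ δ : ℝ≥0∞, 0 < δ → ∃ M : ℝ≥0, 0 < M ∧
    limsup (fun n ↦ P n {ω | (M : ℝ≥0∞) < W n ω}) atTop < δ

/-- `W_n = Ω_{P_n}(1)`, for `[0,∞]`-valued `W_n`: for each `δ > 0` there is an `η > 0` such that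
`limsup_n P_n[W_n < η] < δ`. -/
def IsBigOmegaInProb {Ω : Type*} [MeasurableSpace Ω] (P : ℕ → Measure Ω)
    (W : ℕ → Ω → ℝ≥0∞) : Prop :=
  ∀ δ : ℝ≥0∞, 0 < δ → ∃ η : ℝ≥0, 0 < η ∧
    limsup (fun n ↦ P n {ω | W n ω < (η : ℝ≥0∞)}) atTop < δ

/-- The random variables `X i` are independent conditionally on the σ-algebra `m`, under `P`:
`P[X i ∈ B i for all i | m] = ∏ i, P[X i ∈ B i | m]` almost surely, for all Borel sets `B i`. -/
def CondIndepGiven {Ω ι : Type*} [Fintype ι] (m : MeasurableSpace Ω) [mΩ : MeasurableSpace Ω]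
    (P : Measure Ω) (X : ι → Ω → ℝ) : Prop :=
  ∀ B : ι → Set ℝ, (∀ i, MeasurableSet (B i)) →
    P⟦⋂ i, X i ⁻¹' B i | m⟧ =ᵐ[P] fun ω ↦ ∏ i, (P⟦X i ⁻¹' B i | m⟧) ω

/-- The regular conditional distribution of the random variable `X` given the σ-algebra `m`,
under `P` (a Markov kernel from `(Ω, m)` to `ℝ`). -/
noncomputable def condLaw {Ω : Type*} (m : MeasurableSpace Ω) [mΩ : MeasurableSpace Ω]
    (P : Measure Ω) [IsFiniteMeasure P]
    (X : Ω → ℝ) : @Kernel Ω ℝ m _ :=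
  @condDistrib Ω Ω ℝ _ _ _ mΩ m X id P _

/-- `condLaw m P X` is a version of the conditional probabilities of `X` given `m`. -/
theorem condLaw_ae_eq_condExp {Ω : Type*} (m : MeasurableSpace Ω) [mΩ : MeasurableSpace Ω]
    (P : Measure Ω) [IsFiniteMeasure P] (hm : m ≤ mΩ) {X : Ω → ℝ} (hX : Measurable X)
    {B : Set ℝ} (hB : MeasurableSet B) :
    (fun ω ↦ (condLaw m P X ω).real B) =ᵐ[P] P⟦X ⁻¹' B | m⟧ := by
  have h := @condDistrib_ae_eq_condExp Ω Ω ℝ _ _ _ mΩ P _ id X m B (measurable_id'' hm) hX hB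
  simpa only [MeasurableSpace.comap_id] using! h

/-- The conditional mean `E_P[X | m]`, as the mean of the regular conditional distribution. -/
noncomputable def condMean {Ω : Type*} (m : MeasurableSpace Ω) [mΩ : MeasurableSpace Ω]
    (P : Measure Ω) [IsFiniteMeasure P]
    (X : Ω → ℝ) (ω : Ω) : ℝ :=
  ∫ x, x ∂(condLaw m P X ω)

/-- The conditional variance `Var_P[X | m]`, with values in `[0,∞]`. -/
noncomputable def condEVar {Ω : Type*} (m : MeasurableSpace Ω) [mΩ : MeasurableSpace Ω]
    (P : Measure Ω) [IsFiniteMeasure P]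
    (X : Ω → ℝ) (ω : Ω) : ℝ≥0∞ :=
  ∫⁻ x, ‖x - condMean m P X ω‖ₑ ^ 2 ∂(condLaw m P X ω)

/-- The conditional third absolute central moment `E_P[|X - E_P[X | m]|³ | m]`, with values
in `[0,∞]`. -/
noncomputable def condThirdMoment {Ω : Type*} (m : MeasurableSpace Ω) [mΩ : MeasurableSpace Ω]
    (P : Measure Ω) [IsFiniteMeasure P] (X : Ω → ℝ) (ω : Ω) : ℝ≥0∞ :=
  ∫⁻ x, ‖x - condMean m P X ω‖ₑ ^ 3 ∂(condLaw m P X ω)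

/-- The average conditional variance `S_n² = n⁻¹ ∑ i, Var_P[X i | m]`. -/
noncomputable def avgCondVar {Ω : Type*} (m : MeasurableSpace Ω) [mΩ : MeasurableSpace Ω]
    (P : Measure Ω) [IsFiniteMeasure P]
    {n : ℕ} (X : Fin n → Ω → ℝ) (ω : Ω) : ℝ≥0∞ :=
  (n : ℝ≥0∞)⁻¹ * ∑ i, condEVar m P (X i) ω

/-- The average conditional third absolute central moment
`n⁻¹ ∑ i, E_P[|X i - E_P[X i | m]|³ | m]`. -/
noncomputable def avgCondThirdMoment {Ω : Type*} (m : MeasurableSpace Ω) [mΩ : MeasurableSpace Ω]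
    (P : Measure Ω) [IsFiniteMeasure P] {n : ℕ} (X : Fin n → Ω → ℝ) (ω : Ω) : ℝ≥0∞ :=
  (n : ℝ≥0∞)⁻¹ * ∑ i, condThirdMoment m P (X i) ω

/-- The conditionally standardized sum `√(n / S_n²) * n⁻¹ * ∑ i, (X i - E_P[X i | m])`. -/
noncomputable def condStdSum {Ω : Type*} (m : MeasurableSpace Ω) [mΩ : MeasurableSpace Ω]
    (P : Measure Ω) [IsFiniteMeasure P]
    {n : ℕ} (X : Fin n → Ω → ℝ) (ω : Ω) : ℝ :=
  √((n : ℝ) / (avgCondVar m P X ω).toReal) *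
    ((1 / (n : ℝ)) * ∑ i, (X i ω - condMean m P (X i) ω))

/-- The conditional Kolmogorov distance `sup_t |P[Z ≤ t | m] - Φ(t)|` of `Z` to the standard
normal law, where `t ↦ P[Z ≤ t | m]` is the distribution function of the regular conditional
distribution. -/
noncomputable def condKolmogorovDist {Ω : Type*} (m : MeasurableSpace Ω) [mΩ : MeasurableSpace Ω]
    (P : Measure Ω) [IsFiniteMeasure P] (Z : Ω → ℝ) (ω : Ω) : ℝ≥0∞ :=
  ⨆ t : ℝ, ‖(condLaw m P Z ω).real (Set.Iic t) - cdf (gaussianReal 0 1) t‖ₑ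

/-! The result is an unconditional Berry–Esseen bound with explicit constant, applied pointwise to
the product of the conditional laws. For independent centred `ξ i` whose variances sum to 1,
`abs_measureReal_sum_le_sub_cdf_le` bounds the Kolmogorov distance to the normal law by `58 ∑ E|ξ
i|³`. Where the average conditional variance is at least `η` and the average third moment at most
`M`, the standardized summands have third moments of total at most `M / (√n η^(3/2))`. So `√n` times
the distance is at most `58 M / η^(3/2)`, and the two hypotheses say that this fails only with small
probability.

The Berry–Esseen bound is proved by Stein's method. Let `f` solve `f'(w) = w f(w) + 1_{w < z} -
Φ(z)`. With `W = ∑ ξ i`, the error `P[W < z] - Φ(z)` equals `E[f'(W)] - E[W f(W)]`. Since `ξ i` is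
centred and independent of `W - ξ i`, the last term is a sum of increments `E[ξ i (f(W) - f(W - ξ
i))]`, each close to `E[ξ i ^ 2] E[f'(W)]`. The discrepancy is of third order, except that `f'`
jumps at `z`: the probability that `W - ξ i` lies near `z` is controlled by the concentration
inequality `measureReal_abs_sum_sub_le`.

To pass to conditional laws, conditional independence on rational rectangles identifies the joint
conditional law as a product (`condLawPi_ae_eq_pi`), and the conditional means and variance, being
measurable for the conditioning σ-algebra, may be treated as constants (`condDistrib_comp_prodMk`).
-/

/-! ### Gaussian integrals and tail bounds -/

theorem integrable_exp_neg_sq_div_two : Integrable fun t : ℝ ↦ Real.exp (-t ^ 2 / 2) := by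
  have := integrable_exp_neg_mul_sq (b := 1 / 2) (by norm_num)
  refine this.congr (ae_of_all _ fun t ↦ ?_)
  ring_nf

theorem integral_exp_neg_sq_div_two : ∫ t : ℝ, Real.exp (-t ^ 2 / 2) = √(2 * Real.pi) := by
  have := integral_gaussian (1 / 2)
  rw [show Real.pi / (1 / 2) = 2 * Real.pi by ring] at this
  rw [← this]
  congr with t
  ring_nf

theorem setIntegral_Iio_exp_neg_sq_div_two (z : ℝ) :
    ∫ t in Set.Iio z, Real.exp (-t ^ 2 / 2) = √(2 * Real.pi) * cdf (gaussianReal 0 1) z := by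
  rw [cdf_eq_real, measureReal_def, gaussianReal_apply_eq_integral 0 one_ne_zero,
    ENNReal.toReal_ofReal (setIntegral_nonneg measurableSet_Iic fun x _ ↦ gaussianPDFReal_nonneg _ _ _),
    integral_Iic_eq_integral_Iio, ← integral_const_mul]
  congr with t
  simp only [gaussianPDFReal, NNReal.coe_one, mul_one, sub_zero]
  rw [← mul_assoc, mul_inv_cancel₀ (by positivity), one_mul]

theorem integral_Ioi_exp_neg_sq_div_two_le (x : ℝ) :
    ∫ t in Set.Ioi x, Real.exp (-t ^ 2 / 2) ≤ 3 := by
  calc _ ≤ ∫ t : ℝ, Real.exp (-t ^ 2 / 2) :=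
        setIntegral_le_integral integrable_exp_neg_sq_div_two (ae_of_all _ fun t ↦ (Real.exp_pos _).le)
    _ = √(2 * Real.pi) := integral_exp_neg_sq_div_two
    _ ≤ 3 := by
        rw [Real.sqrt_le_left (by norm_num)]
        nlinarith [Real.pi_lt_four]

/-- On the range of integration `x ≤ t`, and `t * exp (-t ^ 2 / 2)` has an explicit primitive. This
Mills-ratio bound is what makes `w * f w` bounded for the Stein solution. -/
theorem mul_integral_Ioi_exp_neg_sq_div_two_le {x : ℝ} (hx : 0 ≤ x) :
    x * ∫ t in Set.Ioi x, Real.exp (-t ^ 2 / 2) ≤ Real.exp (-x ^ 2 / 2) := by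
  have hd : ∀ t ∈ Set.Ici x, HasDerivAt (fun t : ℝ ↦ -Real.exp (-t ^ 2 / 2))
      (t * Real.exp (-t ^ 2 / 2)) t := fun t _ ↦ by
    have h1 : HasDerivAt (fun t : ℝ ↦ -t ^ 2 / 2) (-t) t := by
      have := ((hasDerivAt_pow 2 t).neg).div_const 2
      refine this.congr_deriv ?_
      simp only [Nat.cast_ofNat, Nat.add_one_sub_one, pow_one]
      ring
    refine h1.exp.neg.congr_deriv ?_
    ring
  have hlim : Tendsto (fun t : ℝ ↦ -Real.exp (-t ^ 2 / 2)) atTop (nhds 0) := by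
    rw [← neg_zero]
    refine Tendsto.neg (Real.tendsto_exp_atBot.comp ?_)
    have : Tendsto (fun t : ℝ ↦ t ^ 2 / 2) atTop atTop :=
      (tendsto_pow_atTop two_ne_zero).atTop_div_const (by norm_num)
    refine (tendsto_neg_atTop_atBot.comp this).congr fun t ↦ ?_
    simp [neg_div]
  have hpos : ∀ t ∈ Set.Ioi x, 0 ≤ t * Real.exp (-t ^ 2 / 2) := fun t ht ↦
    mul_nonneg (hx.trans (le_of_lt ht)) (Real.exp_pos _).le
  have hI := integrableOn_Ioi_deriv_of_nonneg' hd hpos hlim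
  have hE := integral_Ioi_of_hasDerivAt_of_nonneg' hd hpos hlim
  calc _ = ∫ t in Set.Ioi x, x * Real.exp (-t ^ 2 / 2) := (integral_const_mul _ _).symm
    _ ≤ ∫ t in Set.Ioi x, t * Real.exp (-t ^ 2 / 2) := by
        refine setIntegral_mono_on (integrable_exp_neg_sq_div_two.integrableOn.const_mul _) hI
          measurableSet_Ioi fun t ht ↦ ?_
        exact mul_le_mul_of_nonneg_right (le_of_lt ht) (Real.exp_pos _).le
    _ = _ := by rw [hE]; ring

/-! ### Stein's equation for half-line indicators -/

/-- The centred test function `1_{(-∞, z)} - Φ(z)`. -/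
noncomputable def steinTest (z w : ℝ) : ℝ :=
  (Set.Iio z).indicator 1 w - cdf (gaussianReal 0 1) z

theorem abs_steinTest_le (z w : ℝ) : |steinTest z w| ≤ 1 := by
  have h0 := cdf_nonneg (gaussianReal 0 1) z
  have h1 := cdf_le_one (gaussianReal 0 1) z
  unfold steinTest
  by_cases h : w ∈ Set.Iio z
  · rw [Set.indicator_of_mem h, Pi.one_apply, abs_le]; constructor <;> linarith
  · rw [Set.indicator_of_notMem h, abs_le]; constructor <;> linarith

theorem measurable_steinTest (z : ℝ) : Measurable (steinTest z) :=
  (measurable_one.indicator measurableSet_Iio).sub_const _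

theorem continuousWithinAt_steinTest (z w : ℝ) : ContinuousWithinAt (steinTest z) (Set.Ici w) w := by
  refine ContinuousWithinAt.sub ?_ continuousWithinAt_const
  rcases lt_or_ge w z with h | h
  · refine ContinuousAt.continuousWithinAt ?_
    refine (continuousAt_const (y := (1 : ℝ))).congr ?_
    filter_upwards [Iio_mem_nhds h] with v hv
    rw [Set.indicator_of_mem hv, Pi.one_apply]
  · refine (continuousWithinAt_const (b := (0 : ℝ))).congr (fun v hv ↦ ?_) ?_
    · exact Set.indicator_of_notMem (by simpa using h.trans hv) _
    · exact Set.indicator_of_notMem (by simpa using h) _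

/-- The solution is `exp (w ^ 2 / 2)` times the primitive from `-∞` of the test function against the
Gaussian weight. The open half-line makes the test function right-continuous, so the equation holds
at every point, `z` included, with right derivatives; these suffice for the mean value inequality.
-/
theorem exists_stein_solution (z : ℝ) : ∃ f : ℝ → ℝ, Continuous f ∧ (∀ w, |f w| ≤ 6) ∧
    (∀ w, |w * f w| ≤ 1) ∧
    ∀ w, HasDerivWithinAt f (w * f w + steinTest z w) (Set.Ici w) w := by
  set g : ℝ → ℝ := fun t ↦ steinTest z t * Real.exp (-t ^ 2 / 2) with hg
  have hgle : ∀ t, ‖g t‖ ≤ Real.exp (-t ^ 2 / 2) := fun t ↦ by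
    rw [hg, Real.norm_eq_abs, abs_mul, Real.abs_exp]
    exact mul_le_of_le_one_left (Real.exp_pos _).le (abs_steinTest_le z t)
  have hgm : Measurable g := (measurable_steinTest z).mul (by fun_prop)
  have hgi : Integrable g :=
    integrable_exp_neg_sq_div_two.mono' hgm.aestronglyMeasurable (ae_of_all _ hgle)
  -- Centring lets `F w` be written as minus an integral over the right tail, so that in either sign
  -- of `w` it is bounded by the Gaussian tail beyond `|w|`.
  have hg0 : ∫ t, g t = 0 := by
    have : g = fun t ↦ (Set.Iio z).indicator (fun t ↦ Real.exp (-t ^ 2 / 2)) t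
        - cdf (gaussianReal 0 1) z * Real.exp (-t ^ 2 / 2) := by
      ext t
      simp only [hg, steinTest, Set.indicator_apply]
      split_ifs <;> simp [sub_mul]
    rw [this, integral_sub (integrable_exp_neg_sq_div_two.indicator measurableSet_Iio)
      (integrable_exp_neg_sq_div_two.const_mul _), integral_indicator measurableSet_Iio,
      setIntegral_Iio_exp_neg_sq_div_two, integral_const_mul, integral_exp_neg_sq_div_two]
    ring
  set F : ℝ → ℝ := fun w ↦ ∫ t in Set.Iic w, g t with hF
  have hFe : F = fun w ↦ F 0 + ∫ t in (0 : ℝ)..w, g t := by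
    ext w
    rw [← intervalIntegral.integral_Iic_sub_Iic hgi.integrableOn hgi.integrableOn]
    simp [hF]
  have hFd : ∀ w, HasDerivWithinAt F (g w) (Set.Ici w) w := fun w ↦ by
    rw [hFe]
    refine HasDerivWithinAt.const_add _ ?_
    refine intervalIntegral.integral_hasDerivWithinAt_right hgi.intervalIntegrable
      (s := Set.Ici w) (t := Set.Ioi w) hgm.stronglyMeasurable.stronglyMeasurableAtFilter ?_
    exact ((continuousWithinAt_steinTest z w).mul (by fun_prop)).mono Set.Ioi_subset_Ici_self
  have hFc : Continuous F := by
    rw [hFe]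
    exact continuous_const.add (intervalIntegral.continuous_primitive
      (fun a b ↦ hgi.intervalIntegrable) 0)
  have hFle : ∀ w, |F w| ≤ ∫ t in Set.Ioi |w|, Real.exp (-t ^ 2 / 2) := fun w ↦ by
    rcases le_total 0 w with h | h
    · have : F w = -∫ t in Set.Ioi w, g t := by
        have := intervalIntegral.integral_Iic_add_Ioi (b := w) hgi.integrableOn hgi.integrableOn
        rw [hg0] at this
        simp only [hF]; linarith
      rw [this, abs_neg, abs_of_nonneg h]
      exact norm_integral_le_of_norm_le integrable_exp_neg_sq_div_two.integrableOn
        (ae_of_all _ hgle)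
    · have h1 : |F w| ≤ ∫ t in Set.Iic w, Real.exp (-t ^ 2 / 2) :=
        norm_integral_le_of_norm_le integrable_exp_neg_sq_div_two.integrableOn (ae_of_all _ hgle)
      have h2 := integral_comp_neg_Iic w (fun t : ℝ ↦ Real.exp (-t ^ 2 / 2))
      rw [abs_of_nonpos h, ← h2]
      simpa using h1
  have hmul : ∀ w, |w * (Real.exp (w ^ 2 / 2) * F w)| ≤ 1 := fun w ↦ by
    have h1 := mul_integral_Ioi_exp_neg_sq_div_two_le (abs_nonneg w)
    have h2 := mul_le_mul_of_nonneg_left (hFle w) (abs_nonneg w)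
    rw [abs_mul, abs_mul, Real.abs_exp]
    calc _ = Real.exp (w ^ 2 / 2) * (|w| * |F w|) := by ring
      _ ≤ Real.exp (w ^ 2 / 2) * Real.exp (-|w| ^ 2 / 2) := by gcongr; exact h2.trans h1
      _ = 1 := by rw [← Real.exp_add, sq_abs]; ring_nf; exact Real.exp_zero
  refine ⟨fun w ↦ Real.exp (w ^ 2 / 2) * F w, by fun_prop, fun w ↦ ?_, hmul, fun w ↦ ?_⟩
  -- For `1 ≤ |w|` the bound on `w * f w` is enough; otherwise `exp (1 / 2) ≤ 2` and the total mass
  -- is at most 3, whence 6.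
  · rcases le_total 1 |w| with h | h
    · have h1 := hmul w
      rw [abs_mul] at h1
      nlinarith [abs_nonneg (Real.exp (w ^ 2 / 2) * F w)]
    · rw [abs_mul, Real.abs_exp]
      have h1 : Real.exp (w ^ 2 / 2) ≤ 2 := by
        have hw : w ^ 2 ≤ 1 := by rw [← sq_abs]; nlinarith [abs_nonneg w]
        calc Real.exp (w ^ 2 / 2) ≤ Real.exp (1 / 2) := Real.exp_le_exp.2 (by linarith)
          _ ≤ 2 := by
            have h2 := Real.exp_one_lt_d9
            have h3 : Real.exp (1 / 2) * Real.exp (1 / 2) = Real.exp 1 := by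
              rw [← Real.exp_add]; norm_num
            nlinarith [Real.exp_pos (1 / 2)]
      have h2 := (hFle w).trans (integral_Ioi_exp_neg_sq_div_two_le _)
      nlinarith [abs_nonneg (F w), Real.exp_pos (w ^ 2 / 2)]
  · have h1 : HasDerivAt (fun w : ℝ ↦ Real.exp (w ^ 2 / 2)) (Real.exp (w ^ 2 / 2) * w) w := by
      refine (((hasDerivAt_pow 2 w).div_const 2).exp).congr_deriv ?_
      simp
    refine (h1.hasDerivWithinAt.mul (hFd w)).congr_deriv ?_
    have : Real.exp (w ^ 2 / 2) * Real.exp (-w ^ 2 / 2) = 1 := by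
      rw [← Real.exp_add]; ring_nf; exact Real.exp_zero
    simp only [hg]
    linear_combination steinTest z w * this

/-- The test function separates `u` from `v` only if `z` lies between them, hence within `s` of `x`.
-/
theorem steinTest_sub_le {z x u v s : ℝ} (hu : |u - x| ≤ s) (hv : |v - x| ≤ s) :
    |steinTest z u - steinTest z v| ≤ {t : ℝ | |x - z| ≤ t}.indicator 1 s := by
  by_cases h : |x - z| ≤ s
  · rw [Set.indicator_of_mem (by exact h), Pi.one_apply]
    simp only [steinTest, Set.indicator_apply]
    split_ifs <;> simp [abs_sub_comm]
  · rw [Set.indicator_of_notMem (by exact h)]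
    have : u ∈ Set.Iio z ↔ v ∈ Set.Iio z := by
      simp only [Set.mem_Iio]
      rw [abs_le] at h hu hv
      by_contra! h'
      rcases h' with ⟨h1, h2⟩ | ⟨h1, h2⟩ <;> exact h ⟨by linarith, by linarith⟩
    simp only [steinTest, Set.indicator_apply, this]
    simp

/-! ### Increments of the Stein solution -/

section Increment

variable {f : ℝ → ℝ} {z : ℝ}

theorem abs_mul_stein_solution_sub_le (hf : Continuous f) (hf6 : ∀ w, |f w| ≤ 6)
    (hf1 : ∀ w, |w * f w| ≤ 1)
    (hfd : ∀ w, HasDerivWithinAt f (w * f w + steinTest z w) (Set.Ici w) w)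
    {x u v s : ℝ} (hu : |u - x| ≤ s) (hv : |v - x| ≤ s) (huv : |u - v| ≤ s) :
    |u * f u - v * f v| ≤ 8 * (1 + |x|) * s := by
  have hs : 0 ≤ s := (abs_nonneg _).trans hu
  rcases le_total 1 s with h1 | h1
  · calc |u * f u - v * f v| ≤ |u * f u| + |v * f v| := abs_sub _ _
      _ ≤ 2 := by linarith [hf1 u, hf1 v]
      _ ≤ _ := by nlinarith [abs_nonneg x]
  have key : ∀ a b : ℝ, a ≤ b → |a - x| ≤ s → |b - x| ≤ s →
      |b * f b - a * f a| ≤ 8 * (1 + |x|) * (b - a) := fun a b hab ha hb ↦ by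
    refine norm_image_sub_le_of_norm_deriv_right_le_segment (f := fun w ↦ w * f w)
      (f' := fun w ↦ 1 * f w + w * (w * f w + steinTest z w)) (a := a) (b := b)
      (by fun_prop) (fun w _ ↦ (hasDerivWithinAt_id w _).mul (hfd w)) (fun w hw ↦ ?_) b ⟨hab, le_rfl⟩
    have hw1 : |w| ≤ |x| + 1 := by
      rw [abs_le] at ha hb
      have := le_abs_self x
      have := neg_abs_le x
      rw [abs_le]; constructor <;> linarith [hw.1, hw.2]
    have h2 : |w * f w + steinTest z w| ≤ 2 :=
      (abs_add_le _ _).trans (by linarith [hf1 w, abs_steinTest_le z w])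
    calc ‖1 * f w + w * (w * f w + steinTest z w)‖
        ≤ |1 * f w| + |w * (w * f w + steinTest z w)| := abs_add_le _ _
      _ = |f w| + |w| * |w * f w + steinTest z w| := by rw [one_mul, abs_mul w]
      _ ≤ 6 + (|x| + 1) * 2 := by gcongr; exact hf6 w
      _ ≤ 8 * (1 + |x|) := by linarith [abs_nonneg x]
  have hx : 0 ≤ 8 * (1 + |x|) := by positivity
  rcases le_total u v with h | h
  · rw [abs_sub_comm] at huv ⊢
    exact (key u v h hu hv).trans (mul_le_mul_of_nonneg_left ((le_abs_self _).trans huv) hx)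
  · exact (key v u h hv hu).trans (mul_le_mul_of_nonneg_left ((le_abs_self _).trans huv) hx)

/-- Mean value inequality for `f w - w * φ (x + y')`, where `φ` is the right derivative of `f`. The
smooth part of `φ` varies at a Lipschitz rate; its jump counts only when `x` is close to `z`. The
shift `y'` is free so that it can later be an independent copy of `y`. -/
theorem abs_stein_increment_le (hf : Continuous f) (hf6 : ∀ w, |f w| ≤ 6)
    (hf1 : ∀ w, |w * f w| ≤ 1)
    (hfd : ∀ w, HasDerivWithinAt f (w * f w + steinTest z w) (Set.Ici w) w) (x y y' : ℝ) :
    |f (x + y) - f x - y * ((x + y') * f (x + y') + steinTest z (x + y'))| ≤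
      |y| * (8 * (1 + |x|) * (|y| + |y'|) +
        {t : ℝ | |x - z| ≤ t}.indicator 1 (|y| + |y'|)) := by
  set φ : ℝ → ℝ := fun w ↦ w * f w + steinTest z w
  set C := 8 * (1 + |x|) * (|y| + |y'|) + {t : ℝ | |x - z| ≤ t}.indicator 1 (|y| + |y'|)
  have key : ∀ a b : ℝ, a ≤ b → |a - x| ≤ |y| → |b - x| ≤ |y| →
      |(f b - b * φ (x + y')) - (f a - a * φ (x + y'))| ≤ C * (b - a) := fun a b hab ha hb ↦ by
    refine norm_image_sub_le_of_norm_deriv_right_le_segment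
      (f := fun w ↦ f w - w * φ (x + y'))
      (f' := fun w ↦ φ w - 1 * φ (x + y')) (a := a) (b := b)
      (by fun_prop) (fun w _ ↦ (hfd w).sub ((hasDerivWithinAt_id w _).mul_const _))
      (fun w hw ↦ ?_) b ⟨hab, le_rfl⟩
    have hw1 : |w - x| ≤ |y| := by
      rw [abs_le] at ha hb ⊢
      constructor <;> linarith [hw.1, hw.2]
    have hw2 : |w - x| ≤ |y| + |y'| := hw1.trans (by linarith [abs_nonneg y'])
    have hw3 : |x + y' - x| ≤ |y| + |y'| := by
      rw [add_sub_cancel_left]; linarith [abs_nonneg y]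
    have hw4 : |w - (x + y')| ≤ |y| + |y'| := by
      rw [show w - (x + y') = (w - x) - y' by ring]
      exact (abs_sub _ _).trans (by linarith)
    calc ‖φ w - 1 * φ (x + y')‖
        = |(w * f w - (x + y') * f (x + y')) + (steinTest z w - steinTest z (x + y'))| := by
          simp only [φ, Real.norm_eq_abs]; congr 1; ring
      _ ≤ _ := (abs_add_le _ _).trans (add_le_add
          (abs_mul_stein_solution_sub_le hf hf6 hf1 hfd hw2 hw3 hw4) (steinTest_sub_le hw2 hw3))
  rcases le_total 0 y with h | h
  · have := key x (x + y) (by linarith) (by simp) (by simp)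
    rw [add_sub_cancel_left] at this
    rw [abs_of_nonneg h, mul_comm y C]
    refine le_trans (le_of_eq ?_) this
    congr 1; ring
  · have := key (x + y) x (by linarith) (by simp) (by simp)
    rw [abs_of_nonpos h, ← abs_neg]
    refine le_trans (le_of_eq ?_) (this.trans (le_of_eq ?_))
    · congr 1; ring
    · ring

end Increment

/-! ### Truncation and elementary inequalities -/

/-- The truncation of `w` to `[-c, c]`. -/
noncomputable def clampAt (c w : ℝ) : ℝ := max (-c) (min c w)

theorem continuous_clampAt (c : ℝ) : Continuous (clampAt c) := by unfold clampAt; fun_prop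

theorem abs_clampAt_le {c : ℝ} (hc : 0 ≤ c) (w : ℝ) : |clampAt c w| ≤ c := by
  unfold clampAt
  rw [abs_le]
  exact ⟨le_max_left _ _, max_le (by linarith) (min_le_left _ _)⟩

theorem mul_clampAt_sub_nonneg (c w y : ℝ) : 0 ≤ y * (clampAt c w - clampAt c (w - y)) := by
  have hmono : Monotone (clampAt c) := fun u v h ↦ by
    unfold clampAt; exact max_le_max le_rfl (min_le_min le_rfl h)
  rcases le_total 0 y with h | h
  · exact mul_nonneg h (sub_nonneg.2 (hmono (by linarith)))
  · exact mul_nonneg_of_nonpos_of_nonpos h (sub_nonpos.2 (hmono (by linarith)))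

/-- The margin `δ` in the level `l + δ` ensures that from a point of `[-l, l]` a displacement up to
`δ` is not cut off. -/
theorem le_mul_clampAt_sub {l δ w : ℝ} (hδ : 0 ≤ δ) (hw : |w| ≤ l) (y : ℝ) :
    |y| * min |y| δ ≤ y * (clampAt (l + δ) w - clampAt (l + δ) (w - y)) := by
  obtain ⟨h1, h2⟩ := abs_le.1 hw
  have hcw : clampAt (l + δ) w = w := by
    unfold clampAt
    rw [min_eq_right (by linarith), max_eq_right (by linarith)]
  rw [hcw]
  rcases le_total 0 y with h | h
  · rw [abs_of_nonneg h]
    refine mul_le_mul_of_nonneg_left ?_ h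
    have : clampAt (l + δ) (w - y) ≤ max (w - δ) (w - y) :=
      max_le_max (by linarith) (min_le_right _ _)
    rcases le_total y δ with h' | h'
    · rw [max_eq_right (by linarith)] at this
      rw [min_eq_left h']; linarith
    · rw [max_eq_left (by linarith)] at this
      rw [min_eq_right h']; linarith
  · rw [abs_of_nonpos h, show y * (w - clampAt (l + δ) (w - y))
      = -y * (clampAt (l + δ) (w - y) - w) by ring]
    refine mul_le_mul_of_nonneg_left ?_ (by linarith)
    have : min (w + δ) (w - y) ≤ clampAt (l + δ) (w - y) :=
      (min_le_min (by linarith) le_rfl).trans (le_max_right _ _)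
    rcases le_total (-y) δ with h' | h'
    · rw [min_eq_right (by linarith)] at this
      rw [min_eq_left h']; linarith
    · rw [min_eq_left (by linarith)] at this
      rw [min_eq_right h']; linarith

/-- For `δ ≤ |y|` this is `|y| (|y| - 2δ)² ≥ 0` rearranged. -/
theorem sq_sub_le_mul_min {δ : ℝ} (hδ : 0 < δ) (y : ℝ) :
    y ^ 2 - |y| ^ 3 / (4 * δ) ≤ |y| * min |y| δ := by
  have h0 := abs_nonneg y
  rw [← sq_abs]
  rcases le_total |y| δ with h | h
  · rw [min_eq_left h]
    have : 0 ≤ |y| ^ 3 / (4 * δ) := by positivity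
    nlinarith
  · rw [min_eq_right h, sub_le_iff_le_add, ← sub_le_iff_le_add', le_div_iff₀ (by positivity)]
    nlinarith [mul_nonneg h0 (sq_nonneg (|y| - 2 * δ))]

/-! ### Second moments, leave-one-out identity and concentration -/

section

variable {Ω ι : Type*} {mΩ : MeasurableSpace Ω} {P : Measure Ω} {ξ : ι → Ω → ℝ}

theorem memLp_two_of_memLp_three [IsFiniteMeasure P] {X : Ω → ℝ} (h : MemLp X 3 P) :
    MemLp X 2 P := h.mono_exponent (by norm_num)

theorem integrable_of_memLp_three [IsFiniteMeasure P] {X : Ω → ℝ} (h : MemLp X 3 P) :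
    Integrable X P := h.integrable (by norm_num)

theorem integrable_abs_pow_three {X : Ω → ℝ} (h : MemLp X 3 P) :
    Integrable (fun ω ↦ |X ω| ^ 3) P := MemLp.integrable_norm_pow (p := 3) h (by norm_num)

theorem integral_sq_sum_eq [IsProbabilityMeasure P] (hindep : iIndepFun ξ P)
    (h2 : ∀ i, MemLp (ξ i) 2 P) (h0 : ∀ i, ∫ ω, ξ i ω ∂P = 0) (s : Finset ι) :
    ∫ ω, (∑ i ∈ s, ξ i ω) ^ 2 ∂P = ∑ i ∈ s, ∫ ω, ξ i ω ^ 2 ∂P := by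
  have h := IndepFun.variance_sum (s := s) (X := ξ) (μ := P) (fun i _ ↦ h2 i)
    (fun i _ j _ hij ↦ hindep.indepFun hij)
  rw [variance_of_integral_eq_zero] at h
  · simp only [Finset.sum_apply] at h
    rw [h]
    exact Finset.sum_congr rfl fun i _ ↦
      variance_of_integral_eq_zero (h2 i).aestronglyMeasurable.aemeasurable (h0 i)
  · exact (memLp_finsetSum' s fun i _ ↦ h2 i).aestronglyMeasurable.aemeasurable
  · simp only [Finset.sum_apply]
    rw [integral_finsetSum _ fun i _ ↦ (h2 i).integrable (by norm_num)]
    exact Finset.sum_eq_zero fun i _ ↦ h0 i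

theorem integral_abs_sum_le_one [IsProbabilityMeasure P] (hindep : iIndepFun ξ P)
    (h2 : ∀ i, MemLp (ξ i) 2 P) (h0 : ∀ i, ∫ ω, ξ i ω ∂P = 0) {s : Finset ι}
    (hs : ∑ i ∈ s, ∫ ω, ξ i ω ^ 2 ∂P ≤ 1) : ∫ ω, |∑ i ∈ s, ξ i ω| ∂P ≤ 1 := by
  have hL : MemLp (fun ω ↦ ∑ i ∈ s, ξ i ω) 2 P := memLp_finsetSum s fun i _ ↦ h2 i
  rw [← integral_sq_sum_eq hindep h2 h0] at hs
  have hi := hL.integrable_sq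
  calc ∫ ω, |∑ i ∈ s, ξ i ω| ∂P ≤ ∫ ω, (1 + (∑ i ∈ s, ξ i ω) ^ 2) / 2 ∂P := by
        refine integral_mono (hL.integrable (by norm_num)).abs
          (((integrable_const 1).add hi).div_const 2) fun ω ↦ ?_
        simp only
        rw [← sq_abs]
        nlinarith [sq_nonneg (|∑ i ∈ s, ξ i ω| - 1)]
    _ = (1 + ∫ ω, (∑ i ∈ s, ξ i ω) ^ 2 ∂P) / 2 := by
        rw [integral_div, integral_add (integrable_const 1) hi]; simp
    _ ≤ 1 := by linarith

/-- The subtracted terms vanish, because `ξ i` is centred and independent of the sum without it. -/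
theorem integral_mul_eq_sum_integral [IsProbabilityMeasure P] [DecidableEq ι]
    (hindep : iIndepFun ξ P)
    (hm : ∀ i, Measurable (ξ i)) (hi : ∀ i, Integrable (ξ i) P) (h0 : ∀ i, ∫ ω, ξ i ω ∂P = 0)
    (s : Finset ι) {f : ℝ → ℝ} (hf : Measurable f) {C : ℝ} (hC : ∀ w, |f w| ≤ C) :
    ∫ ω, (∑ i ∈ s, ξ i ω) * f (∑ i ∈ s, ξ i ω) ∂P =
      ∑ i ∈ s, ∫ ω, ξ i ω * (f (∑ j ∈ s, ξ j ω) - f (∑ j ∈ s.erase i, ξ j ω)) ∂P := by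
  have hint : ∀ i (t : Finset ι), Integrable (fun ω ↦ ξ i ω * f (∑ j ∈ t, ξ j ω)) P := fun i t ↦
    (hi i).mul_bdd (c := C) (Measurable.aestronglyMeasurable (by fun_prop)) (ae_of_all _ fun ω ↦ hC _)
  simp_rw [Finset.sum_mul]
  rw [integral_finsetSum _ fun i _ ↦ hint i s]
  refine Finset.sum_congr rfl fun i _ ↦ ?_
  simp_rw [mul_sub]
  rw [integral_sub (hint i s) (hint i _)]
  have hI : IndepFun (ξ i) (fun ω ↦ f (∑ j ∈ s.erase i, ξ j ω)) P := by
    have := (hindep.indepFun_finsetSum_of_notMem hm (Finset.notMem_erase i s)).symm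
    have := this.comp measurable_id hf
    simpa [Function.comp_def] using this
  rw [hI.integral_fun_mul_eq_mul_integral (by fun_prop)
    (Measurable.aestronglyMeasurable (by fun_prop)), h0, zero_mul, sub_zero]

theorem integral_abs_sum_sub_integral_le [IsProbabilityMeasure P] {η : ι → Ω → ℝ}
    (hindep : iIndepFun η P) (h2 : ∀ i, MemLp (η i) 2 P) {s : Finset ι} {δ : ℝ} (hδ : 0 < δ)
    (hs : ∑ i ∈ s, ∫ ω, η i ω ^ 2 ∂P ≤ δ ^ 2) :
    ∫ ω, |∑ i ∈ s, η i ω - ∫ ω', ∑ i ∈ s, η i ω' ∂P| ∂P ≤ δ := by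
  have hL : MemLp (fun ω ↦ ∑ i ∈ s, η i ω) 2 P := memLp_finsetSum s fun i _ ↦ h2 i
  have hL' : MemLp (fun ω ↦ ∑ i ∈ s, η i ω - ∫ ω', ∑ i ∈ s, η i ω' ∂P) 2 P :=
    hL.sub (memLp_const _)
  have h := IndepFun.variance_sum (s := s) (X := η) (μ := P) (fun i _ ↦ h2 i)
    (fun i _ j _ hij ↦ hindep.indepFun hij)
  have hv : ∫ ω, (∑ i ∈ s, η i ω - ∫ ω', ∑ i ∈ s, η i ω' ∂P) ^ 2 ∂P ≤ δ ^ 2 := by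
    rw [variance_eq_integral (memLp_finsetSum' s fun i _ ↦ h2 i).aestronglyMeasurable.aemeasurable] at h
    simp only [Finset.sum_apply] at h
    rw [h]
    refine le_trans (Finset.sum_le_sum fun i _ ↦ ?_) hs
    exact variance_le_expectation_sq (h2 i).aestronglyMeasurable
  have hi := hL'.integrable_sq
  calc ∫ ω, |∑ i ∈ s, η i ω - ∫ ω', ∑ i ∈ s, η i ω' ∂P| ∂P
      ≤ ∫ ω, (δ + (∑ i ∈ s, η i ω - ∫ ω', ∑ i ∈ s, η i ω' ∂P) ^ 2 / δ) / 2 ∂P := by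
        refine integral_mono (hL'.integrable (by norm_num)).abs
          (((integrable_const δ).add (hi.div_const δ)).div_const 2) fun ω ↦ ?_
        simp only
        set v := ∑ i ∈ s, η i ω - ∫ ω', ∑ i ∈ s, η i ω' ∂P
        have : δ + v ^ 2 / δ - 2 * |v| = (|v| - δ) ^ 2 / δ := by
          rw [← sq_abs]; field_simp; ring
        have h3 : 0 ≤ (|v| - δ) ^ 2 / δ := by positivity
        linarith
    _ = (δ + (∫ ω, (∑ i ∈ s, η i ω - ∫ ω', ∑ i ∈ s, η i ω' ∂P) ^ 2 ∂P) / δ) / 2 := by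
        rw [integral_div, integral_add (integrable_const δ) (hi.div_const δ), integral_div]; simp
    _ ≤ δ := by
        have : (∫ ω, (∑ i ∈ s, η i ω - ∫ ω', ∑ i ∈ s, η i ω' ∂P) ^ 2 ∂P) / δ ≤ δ := by
          rw [div_le_iff₀ hδ]; nlinarith
        linarith

/-- The concentration inequality of Chen and Shao. -/
theorem measureReal_abs_sum_sub_le [IsProbabilityMeasure P] (hindep : iIndepFun ξ P)
    (hm : ∀ i, Measurable (ξ i)) (h3 : ∀ i, MemLp (ξ i) 3 P) (h0 : ∀ i, ∫ ω, ξ i ω ∂P = 0)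
    {s : Finset ι} (hs1 : ∑ i ∈ s, ∫ ω, ξ i ω ^ 2 ∂P ≤ 1)
    (hs2 : 3 / 4 ≤ ∑ i ∈ s, ∫ ω, ξ i ω ^ 2 ∂P) {δ : ℝ} (hδ : 0 < δ)
    (hs3 : ∑ i ∈ s, ∫ ω, |ξ i ω| ^ 3 ∂P ≤ δ) (m : ℝ) {l : ℝ} (hl : 0 ≤ l) :
    P.real {ω | |∑ i ∈ s, ξ i ω - m| ≤ l} ≤ 2 * l + 4 * δ := by
  classical
  have h2 := fun i ↦ memLp_two_of_memLp_three (h3 i)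
  have hi := fun i ↦ integrable_of_memLp_three (h3 i)
  set A := {ω | |∑ i ∈ s, ξ i ω - m| ≤ l}
  have hA : MeasurableSet A := measurableSet_le (by fun_prop) (by fun_prop)
  -- `g (ξ i)` is the gain of the clamp guaranteed on `A`. Its sum has mean at least `3/4 - 1/4` and
  -- standard deviation at most `δ`.
  set g : ℝ → ℝ := fun y ↦ |y| * min |y| δ with hg
  have hgm : Measurable g := by fun_prop
  have hg0 : ∀ y, 0 ≤ g y := fun y ↦ by positivity
  have hgδ : ∀ y, |g y| ≤ δ * |y| := fun y ↦ by
    rw [abs_of_nonneg (hg0 y), mul_comm δ]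
    exact mul_le_mul_of_nonneg_left (min_le_right _ _) (abs_nonneg _)
  have hη2 : ∀ i, MemLp (fun ω ↦ g (ξ i ω)) 2 P := fun i ↦
    (h2 i).of_le_mul (c := δ) (by fun_prop) (ae_of_all _ fun ω ↦ hgδ _)
  have hηi : ∀ i, Integrable (fun ω ↦ g (ξ i ω)) P := fun i ↦ (hη2 i).integrable (by norm_num)
  have hηI : iIndepFun (fun i ω ↦ g (ξ i ω)) P := hindep.comp (fun _ ↦ g) fun _ ↦ hgm
  have hdev := integral_abs_sum_sub_integral_le hηI hη2 (s := s) hδ (by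
    calc ∑ i ∈ s, ∫ ω, g (ξ i ω) ^ 2 ∂P ≤ ∑ i ∈ s, δ ^ 2 * ∫ ω, ξ i ω ^ 2 ∂P := by
          refine Finset.sum_le_sum fun i _ ↦ ?_
          rw [← integral_const_mul]
          refine integral_mono (hη2 i).integrable_sq ((h2 i).integrable_sq.const_mul _) fun ω ↦ ?_
          simp only
          rw [← sq_abs, ← sq_abs (ξ i ω), ← mul_pow]
          exact pow_le_pow_left₀ (abs_nonneg _) (hgδ _) 2
      _ ≤ δ ^ 2 := by
          rw [← Finset.mul_sum]; exact mul_le_of_le_one_right (sq_nonneg _) hs1)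
  set E := ∫ ω, ∑ i ∈ s, g (ξ i ω) ∂P with hE
  have hE2 : 1 / 2 ≤ E := by
    rw [hE, integral_finsetSum _ fun i _ ↦ hηi i]
    calc (1 / 2 : ℝ) ≤ ∑ i ∈ s, ∫ ω, ξ i ω ^ 2 ∂P - (∑ i ∈ s, ∫ ω, |ξ i ω| ^ 3 ∂P) / (4 * δ) := by
          have : (∑ i ∈ s, ∫ ω, |ξ i ω| ^ 3 ∂P) / (4 * δ) ≤ 1 / 4 := by
            rw [div_le_iff₀ (by positivity)]; linarith
          linarith
      _ = ∑ i ∈ s, ∫ ω, (ξ i ω ^ 2 - |ξ i ω| ^ 3 / (4 * δ)) ∂P := by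
          rw [Finset.sum_div, ← Finset.sum_sub_distrib]
          refine Finset.sum_congr rfl fun i _ ↦ ?_
          rw [integral_sub (h2 i).integrable_sq ((integrable_abs_pow_three (h3 i)).div_const _),
            integral_div]
      _ ≤ _ := Finset.sum_le_sum fun i _ ↦ integral_mono
          ((h2 i).integrable_sq.sub ((integrable_abs_pow_three (h3 i)).div_const _)) (hηi i)
          fun ω ↦ sq_sub_le_mul_min hδ _
  -- `E[W f(W)]` is at most `l + δ` as `E|W| ≤ 1`, and at least `P(A) / 2 - δ` by the leave-one-out
  -- identity. Comparing the two gives the claim.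
  set f : ℝ → ℝ := fun w ↦ clampAt (l + δ) (w - m) with hf
  have hfm : Measurable f := (continuous_clampAt _).measurable.comp (by fun_prop)
  have hfC : ∀ w, |f w| ≤ l + δ := fun w ↦ abs_clampAt_le (by linarith) _
  have hint : ∀ i (t : Finset ι), Integrable (fun ω ↦ ξ i ω * f (∑ j ∈ t, ξ j ω)) P := fun i t ↦
    (hi i).mul_bdd (c := l + δ) (Measurable.aestronglyMeasurable (by fun_prop)) (ae_of_all _ fun ω ↦ hfC _)
  have hint' : ∀ i, Integrable
      (fun ω ↦ ξ i ω * (f (∑ j ∈ s, ξ j ω) - f (∑ j ∈ s.erase i, ξ j ω))) P := fun i ↦ by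
    simp_rw [mul_sub]; exact (hint i s).sub (hint i _)
  have hupper : ∫ ω, (∑ i ∈ s, ξ i ω) * f (∑ i ∈ s, ξ i ω) ∂P ≤ l + δ := by
    have hW : Integrable (fun ω ↦ ∑ i ∈ s, ξ i ω) P := integrable_finsetSum _ fun i _ ↦ hi i
    calc _ ≤ ∫ ω, |∑ i ∈ s, ξ i ω| * (l + δ) ∂P := by
          refine integral_mono (hW.mul_bdd (c := l + δ) (Measurable.aestronglyMeasurable (by fun_prop)) (ae_of_all _ fun ω ↦ hfC _))
            (hW.abs.mul_const _) fun ω ↦ ?_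
          refine (le_abs_self _).trans ?_
          simp only
          rw [abs_mul]
          exact mul_le_mul_of_nonneg_left (hfC _) (abs_nonneg _)
      _ = (∫ ω, |∑ i ∈ s, ξ i ω| ∂P) * (l + δ) := integral_mul_const _ _
      _ ≤ _ := mul_le_of_le_one_left (by linarith) (integral_abs_sum_le_one hindep h2 h0 hs1)
  rw [integral_mul_eq_sum_integral hindep hm hi h0 s hfm hfC,
    ← integral_finsetSum _ fun i _ ↦ hint' i] at hupper
  have hηs : Integrable (fun ω ↦ ∑ i ∈ s, g (ξ i ω)) P := integrable_finsetSum _ fun i _ ↦ hηi i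
  have hdI : Integrable (fun ω ↦ |∑ i ∈ s, g (ξ i ω) - E|) P := (hηs.sub (integrable_const E)).abs
  have hlower : P.real A * (1 / 2) - δ ≤
      ∫ ω, ∑ i ∈ s, ξ i ω * (f (∑ j ∈ s, ξ j ω) - f (∑ j ∈ s.erase i, ξ j ω)) ∂P := by
    calc P.real A * (1 / 2) - δ
        ≤ P.real A * E - ∫ ω, |∑ i ∈ s, g (ξ i ω) - E| ∂P := by
          have := mul_le_mul_of_nonneg_left hE2 (measureReal_nonneg (μ := P) (s := A))
          linarith
      _ = ∫ ω, (A.indicator (fun _ ↦ E) ω - |∑ i ∈ s, g (ξ i ω) - E|) ∂P := by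
          rw [integral_sub ((integrable_const E).indicator hA) hdI, integral_indicator_const _ hA, smul_eq_mul]
      _ ≤ _ := by
          refine integral_mono (((integrable_const E).indicator hA).sub hdI)
            (integrable_finsetSum _ fun i _ ↦ hint' i) fun ω ↦ ?_
          have herase : ∀ i ∈ s, ∑ j ∈ s.erase i, ξ j ω - m = ∑ j ∈ s, ξ j ω - m - ξ i ω :=
            fun i his ↦ by rw [← Finset.add_sum_erase s _ his]; ring
          by_cases hω : ω ∈ A
          · simp only [Set.indicator_of_mem hω]
            calc E - |∑ i ∈ s, g (ξ i ω) - E| ≤ ∑ i ∈ s, g (ξ i ω) := by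
                  have := neg_abs_le (∑ i ∈ s, g (ξ i ω) - E); linarith
              _ ≤ _ := Finset.sum_le_sum fun i his ↦ by
                  simp only [hf]
                  rw [herase i his]
                  exact le_mul_clampAt_sub hδ.le hω _
          · simp only [Set.indicator_of_notMem hω]
            calc 0 - |∑ i ∈ s, g (ξ i ω) - E| ≤ 0 := by simp
              _ ≤ _ := Finset.sum_nonneg fun i his ↦ by
                  simp only [hf]
                  rw [herase i his]
                  exact mul_clampAt_sub_nonneg _ _ _
  linarith

end

/-! ### The Berry–Esseen inequality -/

section

variable {f : ℝ → ℝ} {z : ℝ}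

/-- Here `μ` is the law of one summand and `ν` that of the sum of the others. Taking the second `y`
as an independent copy `y'` turns the difference into one integral over `μ.prod μ`, where the
pointwise increment bound applies. -/
theorem abs_integral_stein_increment_le (hf : Continuous f) (hf6 : ∀ w, |f w| ≤ 6)
    (hf1 : ∀ w, |w * f w| ≤ 1)
    (hfd : ∀ w, HasDerivWithinAt f (w * f w + steinTest z w) (Set.Ici w) w)
    {μ ν : Measure ℝ} [IsProbabilityMeasure μ] [IsProbabilityMeasure ν] (hμ : MemLp id 3 μ)
    (hν : Integrable id ν) (hν1 : ∫ x, |x| ∂ν ≤ 1) {δ : ℝ}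
    (hconc : ∀ l, 0 ≤ l → ν.real {x | |x - z| ≤ l} ≤ 2 * l + 4 * δ) :
    |∫ y, ∫ x, y * (f (x + y) - f x) ∂ν ∂μ - (∫ y, y ^ 2 ∂μ) *
        ∫ y, ∫ x, ((x + y) * f (x + y) + steinTest z (x + y)) ∂ν ∂μ| ≤
      54 * ∫ y, |y| ^ 3 ∂μ + 4 * δ * ∫ y, y ^ 2 ∂μ := by
  set φ : ℝ → ℝ := fun w ↦ w * f w + steinTest z w with hφ
  have hφm : Measurable φ := by
    have := measurable_steinTest z
    fun_prop
  have hφ2 : ∀ w, |φ w| ≤ 2 := fun w ↦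
    (abs_add_le _ _).trans (by linarith [hf1 w, abs_steinTest_le z w])
  have hνa : Integrable (fun x : ℝ ↦ |x|) ν := hν.abs
  have hμ1 : Integrable (fun y : ℝ ↦ y) μ := integrable_of_memLp_three hμ
  have hμ2 : Integrable (fun y : ℝ ↦ y ^ 2) μ := (memLp_two_of_memLp_three hμ).integrable_sq
  have hμ3 : Integrable (fun y : ℝ ↦ |y| ^ 3) μ := integrable_abs_pow_three hμ
  have hf12 : ∀ x y, |f (x + y) - f x| ≤ 12 := fun x y ↦
    (abs_sub _ _).trans (by linarith [hf6 (x + y), hf6 x])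
  set A : ℝ → ℝ := fun y ↦ ∫ x, y * (f (x + y) - f x) ∂ν
  set B : ℝ → ℝ := fun y ↦ ∫ x, φ (x + y) ∂ν
  have hAi : Integrable A μ := by
    have h : Integrable (fun p : ℝ × ℝ ↦ p.1 * (f (p.2 + p.1) - f p.2)) (μ.prod ν) :=
      (hμ1.comp_fst ν).mul_bdd (c := 12) (Measurable.aestronglyMeasurable (by fun_prop))
        (ae_of_all _ fun p ↦ hf12 _ _)
    exact h.integral_prod_left
  have hBi : Integrable B μ := by
    have h : Integrable (fun p : ℝ × ℝ ↦ φ (p.2 + p.1)) (μ.prod ν) :=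
      Integrable.of_bound (Measurable.aestronglyMeasurable (by fun_prop)) 2
        (ae_of_all _ fun p ↦ hφ2 _)
    exact h.integral_prod_left
  have hdiff : ∫ y, A y ∂μ - (∫ y, y ^ 2 ∂μ) * ∫ y, B y ∂μ =
      ∫ p, (A p.1 - p.1 ^ 2 * B p.2) ∂(μ.prod μ) := by
    rw [integral_sub (hAi.comp_fst μ) (hμ2.mul_prod hBi),
      integral_prod_mul (fun y : ℝ ↦ y ^ 2) B, integral_fun_fst]
    simp
  -- The constant 18 is 16 from `8 * E(1 + |x|)` plus 2 from the concentration bound; with the cubic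
  -- inequality below it gives `18 * 3 = 54`.
  have hpt : ∀ p : ℝ × ℝ, ‖A p.1 - p.1 ^ 2 * B p.2‖ ≤
      18 * (p.1 ^ 2 * (|p.1| + |p.2|)) + 4 * δ * p.1 ^ 2 := by
    rintro ⟨y, y'⟩
    simp only
    have hs : 0 ≤ |y| + |y'| := by positivity
    have hi1 : Integrable (fun x ↦ y * (f (x + y) - f x)) ν :=
      (Integrable.of_bound (Measurable.aestronglyMeasurable (by fun_prop)) 12
        (ae_of_all _ fun x ↦ hf12 x y)).const_mul y
    have hi2 : Integrable (fun x ↦ φ (x + y')) ν :=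
      Integrable.of_bound (Measurable.aestronglyMeasurable (by fun_prop)) 2
        (ae_of_all _ fun x ↦ hφ2 _)
    have hset : MeasurableSet {x : ℝ | |x - z| ≤ |y| + |y'|} :=
      measurableSet_le (by fun_prop) (by fun_prop)
    have hb1 : Integrable (fun x : ℝ ↦ 8 * (1 + |x|) * (|y| + |y'|)) ν :=
      (((integrable_const 1).add hνa).const_mul 8).mul_const _
    have hb2 : Integrable ({x : ℝ | |x - z| ≤ |y| + |y'|}.indicator fun _ ↦ (1 : ℝ)) ν :=
      (integrable_const 1).indicator hset
    have hx1 : ∫ x : ℝ, (1 + |x|) ∂ν ≤ 2 := by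
      rw [integral_add (integrable_const 1) hνa]; simp only [integral_const, probReal_univ, one_smul]
      linarith
    calc ‖A y - y ^ 2 * B y'‖
        = ‖∫ x, (y * (f (x + y) - f x) - y ^ 2 * φ (x + y')) ∂ν‖ := by
          rw [integral_sub hi1 (hi2.const_mul _), integral_const_mul (y ^ 2)]
      _ ≤ ∫ x, y ^ 2 * (8 * (1 + |x|) * (|y| + |y'|) +
            {x : ℝ | |x - z| ≤ |y| + |y'|}.indicator (fun _ ↦ (1 : ℝ)) x) ∂ν := by
          refine norm_integral_le_of_norm_le ((hb1.add hb2).const_mul _) (ae_of_all _ fun x ↦ ?_)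
          have h := abs_stein_increment_le hf hf6 hf1 hfd x y y'
          have e : y * (f (x + y) - f x) - y ^ 2 * φ (x + y') =
            y * (f (x + y) - f x - y * φ (x + y')) := by ring
          rw [Real.norm_eq_abs, e, abs_mul, ← sq_abs y, sq, mul_assoc]
          exact mul_le_mul_of_nonneg_left h (abs_nonneg y)
      _ = y ^ 2 * (8 * (∫ x, (1 + |x|) ∂ν) * (|y| + |y'|) +
            ν.real {x : ℝ | |x - z| ≤ |y| + |y'|}) := by
          rw [integral_const_mul, integral_add hb1 hb2, integral_mul_const, integral_const_mul,
            integral_indicator_const _ hset, smul_eq_mul, mul_one]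
      _ ≤ y ^ 2 * (8 * 2 * (|y| + |y'|) + (2 * (|y| + |y'|) + 4 * δ)) := by
          gcongr; exact hconc _ hs
      _ = _ := by ring
  have hcube : ∀ p : ℝ × ℝ, p.1 ^ 2 * (|p.1| + |p.2|) ≤ 2 * |p.1| ^ 3 + |p.2| ^ 3 := by
    rintro ⟨y, y'⟩
    simp only
    rw [← sq_abs]
    have h1 := abs_nonneg y
    have h2 := abs_nonneg y'
    nlinarith [mul_nonneg (add_nonneg h1 h2) (sq_nonneg (|y| - |y'|)), mul_nonneg h2 (sq_nonneg (|y| - |y'|)), pow_nonneg h1 3, pow_nonneg h2 3]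
  have hI1 : Integrable (fun p : ℝ × ℝ ↦ |p.1| ^ 3) (μ.prod μ) := hμ3.comp_fst μ
  have hI2 : Integrable (fun p : ℝ × ℝ ↦ |p.2| ^ 3) (μ.prod μ) := hμ3.comp_snd μ
  have hI3 : Integrable (fun p : ℝ × ℝ ↦ p.1 ^ 2) (μ.prod μ) := hμ2.comp_fst μ
  have hI4 : Integrable (fun p : ℝ × ℝ ↦ 2 * |p.1| ^ 3 + |p.2| ^ 3) (μ.prod μ) :=
    (hI1.const_mul 2).add hI2
  change |∫ y, A y ∂μ - (∫ y, y ^ 2 ∂μ) * ∫ y, B y ∂μ| ≤ _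
  rw [hdiff]
  calc _ ≤ ∫ p : ℝ × ℝ, (18 * (2 * |p.1| ^ 3 + |p.2| ^ 3) + 4 * δ * p.1 ^ 2) ∂(μ.prod μ) := by
        refine norm_integral_le_of_norm_le (f := fun p : ℝ × ℝ ↦ A p.1 - p.1 ^ 2 * B p.2)
          ((hI4.const_mul 18).add (hI3.const_mul _)) (ae_of_all _ fun p ↦ ?_)
        have := hpt p
        have := hcube p
        linarith
    _ = _ := by
        rw [integral_add (hI4.const_mul 18) (hI3.const_mul _),
          integral_const_mul, integral_const_mul, integral_add (hI1.const_mul 2) hI2,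
          integral_const_mul, integral_fun_fst (μ := μ) (ν := μ) fun y : ℝ ↦ |y| ^ 3,
          integral_fun_snd (μ := μ) (ν := μ) fun y : ℝ ↦ |y| ^ 3,
          integral_fun_fst (μ := μ) (ν := μ) fun y : ℝ ↦ y ^ 2]
        simp only [probReal_univ, one_smul]
        ring

end

section

variable {Ω ι : Type*} {mΩ : MeasurableSpace Ω} {P : Measure Ω} {ξ : ι → Ω → ℝ}

theorem integral_eq_iterated_of_indepFun [IsProbabilityMeasure P] {X Y : Ω → ℝ}
    (hX : Measurable X) (hY : Measurable Y) (hXY : IndepFun X Y P) {F : ℝ × ℝ → ℝ}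
    (hF : Measurable F) (hi : Integrable (fun ω ↦ F (Y ω, X ω)) P) :
    ∫ ω, F (Y ω, X ω) ∂P = ∫ y, ∫ x, F (y, x) ∂(P.map X) ∂(P.map Y) := by
  have := Measure.isProbabilityMeasure_map (μ := P) hX.aemeasurable
  have := Measure.isProbabilityMeasure_map (μ := P) hY.aemeasurable
  have hmap := (indepFun_iff_map_prod_eq_prod_map_map hY.aemeasurable hX.aemeasurable).1 hXY.symm
  rw [← integral_prod, ← hmap, integral_map (hY.prodMk hX).aemeasurable hF.aestronglyMeasurable]
  rw [← hmap, integrable_map_measure hF.aestronglyMeasurable (hY.prodMk hX).aemeasurable]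
  exact hi

/-- Integrate `x² ≤ 1/16 + 4|x|³`. It keeps the variance of a leave-one-out sum above `3/4`, as
concentration requires. -/
theorem sq_integral_le_quarter [IsProbabilityMeasure P] {X : Ω → ℝ} (h3 : MemLp X 3 P)
    (h : ∫ ω, |X ω| ^ 3 ∂P ≤ 3 / 64) : ∫ ω, X ω ^ 2 ∂P ≤ 1 / 4 := by
  have hi := integrable_abs_pow_three h3
  calc ∫ ω, X ω ^ 2 ∂P ≤ ∫ ω, (1 / 16 + 4 * |X ω| ^ 3) ∂P := by
        refine integral_mono (memLp_two_of_memLp_three h3).integrable_sq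
          ((integrable_const _).add (hi.const_mul 4)) fun ω ↦ ?_
        simp only
        rw [← sq_abs]
        have h0 := abs_nonneg (X ω)
        rcases le_total |X ω| (1 / 4) with h | h
        · nlinarith [pow_nonneg h0 3]
        · nlinarith [mul_nonneg (sq_nonneg |X ω|) (sub_nonneg.2 h)]
    _ = 1 / 16 + 4 * ∫ ω, |X ω| ^ 3 ∂P := by
        rw [integral_add (integrable_const _) (hi.const_mul 4), integral_const_mul]; simp
    _ ≤ 1 / 4 := by linarith

theorem abs_measureReal_sum_lt_sub_cdf_le [IsProbabilityMeasure P] [Fintype ι]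
    (hindep : iIndepFun ξ P) (hm : ∀ i, Measurable (ξ i)) (h3 : ∀ i, MemLp (ξ i) 3 P)
    (h0 : ∀ i, ∫ ω, ξ i ω ∂P = 0) (hs : ∑ i, ∫ ω, ξ i ω ^ 2 ∂P = 1) {δ : ℝ} (hδ : 0 < δ)
    (hδ' : ∑ i, ∫ ω, |ξ i ω| ^ 3 ∂P ≤ δ) (z : ℝ) :
    |P.real {ω | ∑ i, ξ i ω < z} - cdf (gaussianReal 0 1) z| ≤ 58 * δ := by
  classical
  -- If `3/64 ≤ δ`, then `58 * δ` exceeds 1 and the bound is trivial.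
  rcases le_total (3 / 64) δ with hlarge | hsmall
  · have h1 := cdf_nonneg (gaussianReal 0 1) z
    have h2 := cdf_le_one (gaussianReal 0 1) z
    have h3 := measureReal_nonneg (μ := P) (s := {ω | ∑ i, ξ i ω < z})
    have h4 := measureReal_le_one (μ := P) (s := {ω | ∑ i, ξ i ω < z})
    rw [abs_le]; constructor <;> linarith
  have h2 := fun i ↦ memLp_two_of_memLp_three (h3 i)
  have hi := fun i ↦ integrable_of_memLp_three (h3 i)
  obtain ⟨f, hf, hf6, hf1, hfd⟩ := exists_stein_solution z
  set φ : ℝ → ℝ := fun w ↦ w * f w + steinTest z w with hφ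
  have hTm := measurable_steinTest z
  have hφm : Measurable φ := by fun_prop
  have hφ2 : ∀ w, |φ w| ≤ 2 := fun w ↦
    (abs_add_le _ _).trans (by linarith [hf1 w, abs_steinTest_le z w])
  have hWm : ∀ s : Finset ι, Measurable fun ω ↦ ∑ i ∈ s, ξ i ω := fun s ↦ by fun_prop
  have hφi : Integrable (fun ω ↦ φ (∑ i, ξ i ω)) P :=
    Integrable.of_bound (hφm.comp (hWm _)).aestronglyMeasurable 2 (ae_of_all _ fun ω ↦ hφ2 _)
  have hset : MeasurableSet {ω | ∑ i, ξ i ω < z} := measurableSet_lt (hWm _) measurable_const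
  have hstein : P.real {ω | ∑ i, ξ i ω < z} - cdf (gaussianReal 0 1) z =
      ∑ i, ((∫ ω, ξ i ω ^ 2 ∂P) * ∫ ω, φ (∑ i, ξ i ω) ∂P -
        ∫ ω, ξ i ω * (f (∑ j, ξ j ω) - f (∑ j ∈ Finset.univ.erase i, ξ j ω)) ∂P) := by
    rw [Finset.sum_sub_distrib, ← Finset.sum_mul, hs, one_mul,
      ← integral_mul_eq_sum_integral hindep hm hi h0 _ hf.measurable hf6, ← integral_sub hφi]
    · have e : ∀ ω, φ (∑ i, ξ i ω) - (∑ i, ξ i ω) * f (∑ i, ξ i ω) =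
          {ω | ∑ i, ξ i ω < z}.indicator (fun _ ↦ (1 : ℝ)) ω - cdf (gaussianReal 0 1) z := fun ω ↦ by
        simp [φ, steinTest, Set.indicator_apply]
      simp_rw [e]
      rw [integral_sub ((integrable_const 1).indicator hset) (integrable_const _),
        integral_indicator_const _ hset]
      simp
    · exact Integrable.of_bound (Measurable.aestronglyMeasurable (by fun_prop)) 1
        (ae_of_all _ fun ω ↦ hf1 _)
  have hterm : ∀ i, |(∫ ω, ξ i ω ^ 2 ∂P) * ∫ ω, φ (∑ i, ξ i ω) ∂P -
      ∫ ω, ξ i ω * (f (∑ j, ξ j ω) - f (∑ j ∈ Finset.univ.erase i, ξ j ω)) ∂P| ≤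
      54 * ∫ ω, |ξ i ω| ^ 3 ∂P + 4 * δ * ∫ ω, ξ i ω ^ 2 ∂P := fun i ↦ by
    set X : Ω → ℝ := fun ω ↦ ∑ j ∈ Finset.univ.erase i, ξ j ω with hX
    have hXm : Measurable X := hWm _
    have hWX : ∀ ω, ∑ j, ξ j ω = X ω + ξ i ω := fun ω ↦
      (Finset.sum_erase_add _ _ (Finset.mem_univ i)).symm
    have hI : IndepFun X (ξ i) P := by
      have := hindep.indepFun_finsetSum_of_notMem hm (Finset.notMem_erase i Finset.univ)
      convert! this using 1
      ext ω; simp [hX]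
    have := Measure.isProbabilityMeasure_map (μ := P) hXm.aemeasurable
    have := Measure.isProbabilityMeasure_map (μ := P) (hm i).aemeasurable
    have hρ := Finset.single_le_sum (f := fun i ↦ ∫ ω, |ξ i ω| ^ 3 ∂P)
      (fun i _ ↦ integral_nonneg fun ω ↦ by positivity) (Finset.mem_univ i)
    have hσ := sq_integral_le_quarter (h3 i) (by linarith)
    have herase := Finset.sum_erase_add Finset.univ (fun i ↦ ∫ ω, ξ i ω ^ 2 ∂P) (Finset.mem_univ i)
    have herase3 := Finset.sum_erase_add Finset.univ (fun i ↦ ∫ ω, |ξ i ω| ^ 3 ∂P)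
      (Finset.mem_univ i)
    have hρ0 : 0 ≤ ∫ ω, |ξ i ω| ^ 3 ∂P := integral_nonneg fun ω ↦ by positivity
    have hσ0 : 0 ≤ ∫ ω, ξ i ω ^ 2 ∂P := integral_nonneg fun ω ↦ by positivity
    have key := abs_integral_stein_increment_le hf hf6 hf1 hfd (μ := P.map (ξ i)) (ν := P.map X)
      (δ := δ) ((memLp_map_measure_iff (by fun_prop) (hm i).aemeasurable).2 (h3 i))
      ((integrable_map_measure (by fun_prop) hXm.aemeasurable).2
        (integrable_finsetSum _ fun j _ ↦ hi j)) (by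
        rw [integral_map hXm.aemeasurable (by fun_prop)]
        exact integral_abs_sum_le_one hindep h2 h0 (by linarith)) (fun l hl ↦ by
        rw [map_measureReal_apply hXm (measurableSet_le (by fun_prop) (by fun_prop))]
        exact measureReal_abs_sum_sub_le hindep hm h3 h0 (by linarith) (by linarith) hδ
          (by linarith) z hl)
    rw [integral_map (hm i).aemeasurable (f := fun y : ℝ ↦ |y| ^ 3) (by fun_prop),
      integral_map (hm i).aemeasurable (f := fun y : ℝ ↦ y ^ 2) (by fun_prop),
      ← integral_eq_iterated_of_indepFun hXm (hm i) hI
        (F := fun p ↦ p.1 * (f (p.2 + p.1) - f p.2)) (by fun_prop) ?_,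
      ← integral_eq_iterated_of_indepFun hXm (hm i) hI (F := fun p ↦ φ (p.2 + p.1))
        (by fun_prop) ?_] at key
    · rw [abs_sub_comm]
      simp_rw [hWX]
      exact key
    · simp_rw [← hWX]; exact hφi
    · exact (hi i).mul_bdd (c := 12) (Measurable.aestronglyMeasurable (by fun_prop))
        (ae_of_all _ fun ω ↦ (abs_sub _ _).trans (by linarith [hf6 (X ω + ξ i ω), hf6 (X ω)]))
  rw [hstein]
  calc _ ≤ ∑ i, (54 * ∫ ω, |ξ i ω| ^ 3 ∂P + 4 * δ * ∫ ω, ξ i ω ^ 2 ∂P) :=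
        (Finset.abs_sum_le_sum_abs _ _).trans (Finset.sum_le_sum fun i _ ↦ hterm i)
    _ = 54 * ∑ i, ∫ ω, |ξ i ω| ^ 3 ∂P + 4 * δ := by
        rw [Finset.sum_add_distrib, ← Finset.mul_sum, ← Finset.mul_sum, hs, mul_one]
    _ ≤ 58 * δ := by linarith

/-- The Berry–Esseen inequality for independent, not necessarily identically distributed, random
variables. -/
theorem abs_measureReal_sum_le_sub_cdf_le [IsProbabilityMeasure P] [Fintype ι]
    (hindep : iIndepFun ξ P) (hm : ∀ i, Measurable (ξ i)) (h3 : ∀ i, MemLp (ξ i) 3 P)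
    (h0 : ∀ i, ∫ ω, ξ i ω ∂P = 0) (hs : ∑ i, ∫ ω, ξ i ω ^ 2 ∂P = 1) {δ : ℝ} (hδ : 0 < δ)
    (hδ' : ∑ i, ∫ ω, |ξ i ω| ^ 3 ∂P ≤ δ) (z : ℝ) :
    |P.real {ω | ∑ i, ξ i ω ≤ z} - cdf (gaussianReal 0 1) z| ≤ 58 * δ := by
  have h := abs_measureReal_sum_lt_sub_cdf_le hindep hm h3 h0 hs hδ hδ'
  have hlow : P.real {ω | ∑ i, ξ i ω < z} ≤ P.real {ω | ∑ i, ξ i ω ≤ z} :=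
    measureReal_mono (Set.ofPred_subset_ofPred.2 fun ω hω ↦ hω.le)
  -- Right-continuity of `Φ` transfers the bound from strict to weak inequalities.
  have hup : P.real {ω | ∑ i, ξ i ω ≤ z} ≤ cdf (gaussianReal 0 1) z + 58 * δ := by
    have hlim : Tendsto (fun w ↦ cdf (gaussianReal 0 1) w + 58 * δ) (nhdsWithin z (Set.Ioi z))
        (nhds (cdf (gaussianReal 0 1) z + 58 * δ)) :=
      (((cdf (gaussianReal 0 1)).right_continuous z).mono Set.Ioi_subset_Ici_self).tendsto.add_const _
    refine ge_of_tendsto hlim ?_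
    filter_upwards [self_mem_nhdsWithin] with w hw
    have h1 : P.real {ω | ∑ i, ξ i ω ≤ z} ≤ P.real {ω | ∑ i, ξ i ω < w} :=
      measureReal_mono (Set.ofPred_subset_ofPred.2 fun ω hω ↦ lt_of_le_of_lt hω hw)
    linarith [(abs_le.1 (h w)).2]
  rw [abs_le]
  constructor <;> linarith [(abs_le.1 (h z)).1]

end

/-! ### Standardized sums under a product measure -/

section StandardizedSum

variable {X : ℝ → ℝ} {μ : Measure ℝ}

theorem integral_abs_pow_eq_toReal_lintegral (hX : Measurable X) (k : ℕ) :
    ∫ x, |X x| ^ k ∂μ = (∫⁻ x, ‖X x‖ₑ ^ k ∂μ).toReal := by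
  rw [integral_eq_lintegral_of_nonneg_ae (ae_of_all _ fun x ↦ by positivity)
    (Measurable.aestronglyMeasurable (by fun_prop))]
  congr with x
  rw [← ofReal_norm, ← ENNReal.ofReal_pow (norm_nonneg _), Real.norm_eq_abs]

theorem memLp_three_of_lintegral_lt_top (hX : Measurable X) (h : ∫⁻ x, ‖X x‖ₑ ^ 3 ∂μ < ∞) :
    MemLp X 3 μ := by
  refine ⟨hX.aestronglyMeasurable, ?_⟩
  rw [eLpNorm_lt_top_iff_lintegral_rpow_enorm_lt_top (by norm_num) (by norm_num)]
  simpa using h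

theorem abs_map_pi_Iic_sub_cdf_le {n : ℕ} (μ : Fin n → Measure ℝ) [∀ i, IsProbabilityMeasure (μ i)]
    {η M : ℝ≥0} (hη : 0 < η) (hM : 0 < M) {V : ℝ≥0∞}
    (hV : V = (n : ℝ≥0∞)⁻¹ * ∑ i, ∫⁻ x, ‖x - ∫ y, y ∂(μ i)‖ₑ ^ 2 ∂(μ i)) (hηV : η ≤ V)
    (hT : (n : ℝ≥0∞)⁻¹ * ∑ i, ∫⁻ x, ‖x - ∫ y, y ∂(μ i)‖ₑ ^ 3 ∂(μ i) ≤ M) (t : ℝ) :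
    |((Measure.pi μ).map fun x ↦ √((n : ℝ) / V.toReal) *
        ((1 / (n : ℝ)) * ∑ i, (x i - ∫ y, y ∂(μ i)))).real (Set.Iic t) -
      cdf (gaussianReal 0 1) t| ≤ 58 * (M / (√(n : ℝ) * √(η : ℝ) ^ 3)) := by
  -- For `n = 0` the empty sum forces `V = 0`, contrary to `η ≤ V`.
  have hn : 0 < n := by
    rcases Nat.eq_zero_or_pos n with rfl | h
    · simp only [Finset.univ_eq_empty, Finset.sum_empty, mul_zero] at hV
      rw [hV] at hηV
      simp only [nonpos_iff_eq_zero, ENNReal.coe_eq_zero] at hηV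
      exact absurd hηV hη.ne'
    · exact h
  have hnR : (0 : ℝ) < n := by exact_mod_cast hn
  set X : Fin n → ℝ → ℝ := fun i x ↦ x - ∫ y, y ∂(μ i) with hX
  have hXm : ∀ i, Measurable (X i) := fun i ↦ by fun_prop
  have hfin : ∀ i, ∫⁻ x, ‖X i x‖ₑ ^ 3 ∂(μ i) < ∞ := fun i ↦ by
    have h1 : ∑ i, ∫⁻ x, ‖X i x‖ₑ ^ 3 ∂(μ i) ≠ ∞ := fun h ↦ by
      have h2 := hT
      rw [show ∑ i, ∫⁻ x, ‖x - ∫ y, y ∂(μ i)‖ₑ ^ 3 ∂(μ i) = ∞ from h,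
        ENNReal.mul_top (by simp)] at h2
      exact absurd h2 (by simp)
    exact (ENNReal.sum_lt_top.1 h1.lt_top) i (Finset.mem_univ i)
  have hL3 : ∀ i, MemLp (X i) 3 (μ i) := fun i ↦ memLp_three_of_lintegral_lt_top (hXm i) (hfin i)
  -- The finite third moment gives integrability, so the centring constant is a genuine mean and not
  -- the default value of the integral.
  have hX0 : ∀ i, ∫ x, X i x ∂(μ i) = 0 := fun i ↦ by
    have hid : Integrable (fun x : ℝ ↦ x) (μ i) := by
      refine ((integrable_of_memLp_three (hL3 i)).add (integrable_const (∫ y, y ∂(μ i)))).congr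
        (ae_of_all _ fun x ↦ ?_)
      simp [hX]
    simp only [hX]
    rw [integral_sub hid (integrable_const _)]
    simp
  have hsq : ∀ i, ∫⁻ x, ‖X i x‖ₑ ^ 2 ∂(μ i) ≠ ∞ := fun i ↦ by
    have h := (eLpNorm_lt_top_iff_lintegral_rpow_enorm_lt_top (by norm_num) (by norm_num)).1
      (memLp_two_of_memLp_three (hL3 i)).eLpNorm_lt_top
    refine ne_of_lt ?_
    simpa using h
  have hVtop : V ≠ ∞ := by
    rw [hV]
    exact ENNReal.mul_ne_top (by simp [hn.ne']) (ENNReal.sum_ne_top.2 fun i _ ↦ hsq i)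
  set v := V.toReal with hv
  have hηv : (η : ℝ) ≤ v := ENNReal.toReal_mono hVtop hηV
  have hηR : (0 : ℝ) < η := hη
  have hv0 : 0 < v := hηR.trans_le hηv
  have hvar : ∑ i, ∫ x, X i x ^ 2 ∂(μ i) = n * v := by
    have h1 : ∀ i, ∫ x, X i x ^ 2 ∂(μ i) = (∫⁻ x, ‖X i x‖ₑ ^ 2 ∂(μ i)).toReal := fun i ↦ by
      rw [← integral_abs_pow_eq_toReal_lintegral (hXm i)]; simp_rw [sq_abs]
    simp_rw [h1]
    rw [hv, hV, ENNReal.toReal_mul, ENNReal.toReal_sum fun i _ ↦ hsq i, ENNReal.toReal_inv,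
      ENNReal.toReal_natCast, mul_inv_cancel_left₀ hnR.ne']
  have hthird : ∑ i, ∫ x, |X i x| ^ 3 ∂(μ i) ≤ n * M := by
    have h2 := ENNReal.toReal_mono ENNReal.coe_ne_top hT
    rw [ENNReal.toReal_mul, ENNReal.toReal_sum fun i _ ↦ (hfin i).ne, ENNReal.toReal_inv,
      ENNReal.toReal_natCast, ENNReal.coe_toReal, inv_mul_le_iff₀ hnR] at h2
    refine le_trans (le_of_eq ?_) h2
    exact Finset.sum_congr rfl fun i _ ↦ integral_abs_pow_eq_toReal_lintegral (hXm i) 3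
  set c : ℝ := √((n : ℝ) / v) * (1 / (n : ℝ)) with hc
  have hc0 : 0 ≤ c := by positivity
  have hc2 : c ^ 2 * (n * v) = 1 := by
    rw [hc, mul_pow, Real.sq_sqrt (by positivity)]
    field_simp
  have hc3 : c ^ 3 * (n * M) ≤ M / (√(n : ℝ) * √(η : ℝ) ^ 3) := by
    have h1 : c = 1 / (√(n : ℝ) * √v) := by
      rw [hc, Real.sqrt_div hnR.le]
      have : √(n : ℝ) ^ 2 = n := Real.sq_sqrt hnR.le
      have h0 : 0 < √(n : ℝ) := Real.sqrt_pos.2 hnR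
      have h0' : 0 < √v := Real.sqrt_pos.2 hv0
      rw [← this]
      field_simp
      rw [Real.sqrt_sq h0.le]
    have h2 : c ^ 3 * (n * M) = M / (√(n : ℝ) * √v ^ 3) := by
      have h0 : 0 < √(n : ℝ) := Real.sqrt_pos.2 hnR
      have h0' : 0 < √v := Real.sqrt_pos.2 hv0
      have : (n : ℝ) = √(n : ℝ) ^ 2 := (Real.sq_sqrt hnR.le).symm
      rw [h1]
      nth_rw 2 [this]
      field_simp
    rw [h2]
    have h0 : 0 < √(n : ℝ) := Real.sqrt_pos.2 hnR
    have h0' : 0 < √(η : ℝ) := Real.sqrt_pos.2 hηR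
    gcongr
  set ξ : Fin n → (Fin n → ℝ) → ℝ := fun i x ↦ c * X i (x i) with hξ
  have hξm : ∀ i, Measurable (ξ i) := fun i ↦ by fun_prop
  have hBE := abs_measureReal_sum_le_sub_cdf_le (P := Measure.pi μ) (ξ := ξ)
    (iIndepFun_pi (X := fun i x ↦ c * X i x) fun i ↦ by fun_prop) hξm
    (fun i ↦ ((hL3 i).const_mul c).comp_measurePreserving (measurePreserving_eval μ i))
    (fun i ↦ by
      simp only [hξ]
      rw [integral_const_mul, integral_comp_eval (μ := μ) (i := i) (f := X i)
        (hXm i).aestronglyMeasurable, hX0, mul_zero])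
    (by
      simp only [hξ, mul_pow, integral_const_mul]
      rw [← Finset.mul_sum, ← hc2, ← hvar]
      congr 1
      exact Finset.sum_congr rfl fun i _ ↦
        integral_comp_eval (μ := μ) (i := i) (f := fun x ↦ X i x ^ 2)
          (Measurable.aestronglyMeasurable (by fun_prop)))
    (δ := M / (√(n : ℝ) * √(η : ℝ) ^ 3))
    (div_pos hM (mul_pos (Real.sqrt_pos.2 hnR) (pow_pos (Real.sqrt_pos.2 hηR) 3)))
    (by
      simp only [hξ, abs_mul, mul_pow, integral_const_mul, abs_of_nonneg hc0]
      rw [← Finset.mul_sum]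
      refine le_trans (mul_le_mul_of_nonneg_left (le_trans (le_of_eq ?_) hthird) (by positivity)) hc3
      exact Finset.sum_congr rfl fun i _ ↦
        integral_comp_eval (μ := μ) (i := i) (f := fun x ↦ |X i x| ^ 3)
          (Measurable.aestronglyMeasurable (by fun_prop))) t
  rw [map_measureReal_apply (by fun_prop) measurableSet_Iic]
  convert hBE using 5
  ext x
  simp only [Set.mem_preimage, Set.mem_Iic, Set.mem_ofPred_eq, hξ, ← Finset.mul_sum, hc, hX]
  rw [mul_assoc]

end StandardizedSum

/-! ### Conditional laws of vectors and of standardized sums -/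

section ConditionalLaw

/-- Both sides disintegrate the joint law of `X` and `g (X, Y)`, and such a disintegration is almost
surely unique. -/
theorem condDistrib_comp_prodMk {α β E F : Type*} {mα : MeasurableSpace α} {mβ : MeasurableSpace β}
    [MeasurableSpace E] [StandardBorelSpace E] [Nonempty E]
    [MeasurableSpace F] [StandardBorelSpace F] [Nonempty F] (μ : Measure α) [IsFiniteMeasure μ]
    {X : α → β} {Y : α → E} (hX : Measurable X) (hY : Measurable Y) {g : β × E → F}
    (hg : Measurable g) :
    ∀ᵐ a ∂μ, condDistrib (fun a ↦ g (X a, Y a)) X μ (X a) =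
      (condDistrib Y X μ (X a)).map fun e ↦ g (X a, e) := by
  set κ := condDistrib Y X μ
  have hκ : ∀ b, ((Kernel.id ×ₖ κ).map g) b = (κ b).map fun e ↦ g (b, e) := fun b ↦ by
    rw [Kernel.map_apply _ hg, Kernel.prod_apply, Kernel.id_apply, Measure.dirac_prod,
      Measure.map_map hg measurable_prodMk_left]
    rfl
  have h := condDistrib_ae_eq_of_measure_eq_compProd X (μ := μ) (Y := fun a ↦ g (X a, Y a))
    (κ := (Kernel.id ×ₖ κ).map g) (hg.comp (hX.prodMk hY)).aemeasurable (by
      ext s hs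
      have hs' : MeasurableSet {p : β × E | (p.1, g p) ∈ s} := (measurable_fst.prodMk hg) hs
      rw [Measure.map_apply (by fun_prop) hs, Measure.compProd_apply hs]
      have h1 : ∀ b, ((Kernel.id ×ₖ κ).map g) b (Prod.mk b ⁻¹' s) =
          κ b (Prod.mk b ⁻¹' {p : β × E | (p.1, g p) ∈ s}) := fun b ↦ by
        rw [hκ, Measure.map_apply (by fun_prop) (measurable_prodMk_left hs)]
        rfl
      simp_rw [h1]
      rw [← Measure.compProd_apply hs', compProd_map_condDistrib hY.aemeasurable,
        Measure.map_apply (hX.prodMk hY) hs']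
      rfl)
  filter_upwards [ae_of_ae_map hX.aemeasurable h] with a ha
  rw [ha, hκ]

/-- Rational half-lines form a countable generating π-system, so the null sets of conditional
independence, one per rectangle, can be united. -/
theorem pi_eq_of_forall_Iic_rat {ι : Type*} [Fintype ι] {μ : ι → Measure ℝ}
    [∀ i, IsProbabilityMeasure (μ i)] {ν : Measure (ι → ℝ)}
    (h : ∀ q : ι → ℚ, ν (Set.univ.pi fun i ↦ Set.Iic (q i : ℝ)) = ∏ i, μ i (Set.Iic (q i : ℝ))) :
    Measure.pi μ = ν := by
  refine Measure.pi_eq_generateFrom (C := fun _ ↦ ⋃ a : ℚ, {Set.Iic (a : ℝ)})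
    (fun i ↦ Real.borel_eq_generateFrom_Iic_rat.symm.trans (BorelSpace.measurable_eq (α := ℝ)).symm)
    (fun _ ↦ Real.isPiSystem_Iic_rat)
    (fun i ↦ ⟨fun n ↦ Set.Iic ((n : ℚ) : ℝ), fun n ↦ Set.mem_iUnion.2 ⟨n, rfl⟩,
      fun n ↦ measure_lt_top _ _, ?_⟩) fun s hs ↦ ?_
  · refine Set.eq_univ_of_forall fun x ↦ ?_
    obtain ⟨n, hn⟩ := exists_nat_ge x
    exact Set.mem_iUnion.2 ⟨n, by simpa using hn⟩
  · choose q hq using fun i ↦ Set.mem_iUnion.1 (hs i)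
    obtain rfl : s = fun i ↦ Set.Iic (q i : ℝ) := funext fun i ↦ hq i
    exact h q

theorem measurable_integral_id_kernel {β : Type*} {mβ : MeasurableSpace β} (κ : Kernel β ℝ) :
    Measurable fun b ↦ ∫ x, x ∂(κ b) :=
  (StronglyMeasurable.integral_kernel (κ := κ) stronglyMeasurable_id).measurable

theorem measurable_lintegral_enorm_sub_sq_kernel {β : Type*} {mβ : MeasurableSpace β}
    (κ : Kernel β ℝ) [IsMarkovKernel κ] :
    Measurable fun b ↦ ∫⁻ x, ‖x - ∫ y, y ∂(κ b)‖ₑ ^ 2 ∂(κ b) := by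
  have h := measurable_integral_id_kernel κ
  refine Measurable.lintegral_kernel_prod_right (f := fun b x ↦ ‖x - ∫ y, y ∂(κ b)‖ₑ ^ 2) ?_
  exact ((measurable_snd.sub (h.comp measurable_fst)).enorm).pow_const 2

theorem measurable_standardizedSum {β : Type*} {mβ : MeasurableSpace β} {n : ℕ} {V : β → ℝ≥0∞}
    (hV : Measurable V) {c : Fin n → β → ℝ} (hc : ∀ i, Measurable (c i)) :
    Measurable fun p : β × (Fin n → ℝ) ↦ √((n : ℝ) / (V p.1).toReal) *
      ((1 / (n : ℝ)) * ∑ i, (p.2 i - c i p.1)) := by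
  fun_prop

/-- The regular conditional distribution of the random vector `X` given the σ-algebra `m`. -/
noncomputable def condLawPi {Ω ι : Type*} [Fintype ι] (m : MeasurableSpace Ω)
    [mΩ : MeasurableSpace Ω] (P : Measure Ω) [IsFiniteMeasure P] (X : ι → Ω → ℝ) :
    @Kernel Ω (ι → ℝ) m _ :=
  @condDistrib Ω Ω (ι → ℝ) _ _ _ mΩ m (fun ω i ↦ X i ω) id P _

variable {Ω : Type*} {m : MeasurableSpace Ω} [mΩ : MeasurableSpace Ω] {P : Measure Ω}
  [IsFiniteMeasure P]

instance condLaw.instIsProbabilityMeasure (X : Ω → ℝ) (ω : Ω) :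
    IsProbabilityMeasure (condLaw m P X ω) := by
  unfold condLaw; infer_instance

instance condLawPi.instIsProbabilityMeasure {ι : Type*} [Fintype ι] (X : ι → Ω → ℝ) (ω : Ω) :
    IsProbabilityMeasure (condLawPi m P X ω) := by
  unfold condLawPi; infer_instance

theorem condLawPi_ae_eq_condExp {ι : Type*} [Fintype ι] (hm : m ≤ mΩ) {X : ι → Ω → ℝ}
    (hX : ∀ i, Measurable (X i)) {B : Set (ι → ℝ)} (hB : MeasurableSet B) :
    (fun ω ↦ (condLawPi m P X ω).real B) =ᵐ[P] P⟦(fun ω i ↦ X i ω) ⁻¹' B | m⟧ := by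
  have h := @condDistrib_ae_eq_condExp Ω Ω (ι → ℝ) _ _ _ mΩ P _ id (fun ω i ↦ X i ω) m B
    (measurable_id'' hm) (measurable_pi_lambda _ hX) hB
  simpa only [MeasurableSpace.comap_id] using! h

theorem condLawPi_ae_eq_pi {ι : Type*} [Fintype ι] (hm : m ≤ mΩ) {X : ι → Ω → ℝ}
    (hX : ∀ i, Measurable (X i)) (hindep : CondIndepGiven m P X) :
    ∀ᵐ ω ∂P, condLawPi m P X ω = Measure.pi fun i ↦ condLaw m P (X i) ω := by
  have h : ∀ᵐ ω ∂P, ∀ q : ι → ℚ, condLawPi m P X ω (Set.univ.pi fun i ↦ Set.Iic (q i : ℝ)) =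
      ∏ i, condLaw m P (X i) ω (Set.Iic (q i : ℝ)) := by
    rw [ae_all_iff]
    intro q
    have h1 : ∀ᵐ ω ∂P, ∀ i, (condLaw m P (X i) ω).real (Set.Iic (q i : ℝ)) =
        (P⟦X i ⁻¹' Set.Iic (q i : ℝ) | m⟧) ω :=
      ae_all_iff.2 fun i ↦ condLaw_ae_eq_condExp m P hm (hX i) measurableSet_Iic
    have h2 := condLawPi_ae_eq_condExp (P := P) hm hX
      (MeasurableSet.univ_pi fun i ↦ measurableSet_Iic (a := (q i : ℝ)))
    have h3 := hindep (fun i ↦ Set.Iic (q i : ℝ)) fun i ↦ measurableSet_Iic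
    have hpre : (fun ω i ↦ X i ω) ⁻¹' (Set.univ.pi fun i ↦ Set.Iic (q i : ℝ)) =
        ⋂ i, X i ⁻¹' Set.Iic (q i : ℝ) := by
      ext ω; simp [Pi.le_def]
    rw [hpre] at h2
    filter_upwards [h1, h2, h3] with ω h1 h2 h3
    rw [← ENNReal.toReal_eq_toReal_iff' (measure_ne_top _ _)
      (ENNReal.prod_ne_top fun i _ ↦ measure_ne_top _ _), ENNReal.toReal_prod]
    change (condLawPi m P X ω).real _ = ∏ i, (condLaw m P (X i) ω).real _
    rw [h2, h3]
    exact Finset.prod_congr rfl fun i _ ↦ (h1 i).symm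
  filter_upwards [h] with ω hω
  exact (pi_eq_of_forall_Iic_rat hω).symm

theorem measurable_condMean (X : Ω → ℝ) : Measurable[m] (condMean m P X) :=
  @measurable_integral_id_kernel Ω m (condLaw m P X)

theorem measurable_avgCondVar {n : ℕ} (X : Fin n → Ω → ℝ) : Measurable[m] (avgCondVar m P X) := by
  have hκ : ∀ i, @IsMarkovKernel Ω ℝ m _ (condLaw m P (X i)) := fun i ↦ by
    unfold condLaw; infer_instance
  exact Measurable.const_mul (Finset.measurable_fun_sum _ fun i _ ↦
    @measurable_lintegral_enorm_sub_sq_kernel Ω m (condLaw m P (X i)) (hκ i)) _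

theorem condLaw_condStdSum_ae_eq (hm : m ≤ mΩ) {n : ℕ} {X : Fin n → Ω → ℝ}
    (hX : ∀ i, Measurable (X i)) (hindep : CondIndepGiven m P X) :
    ∀ᵐ ω ∂P, condLaw m P (condStdSum m P X) ω =
      (Measure.pi fun i ↦ condLaw m P (X i) ω).map fun x ↦
        √((n : ℝ) / (avgCondVar m P X ω).toReal) *
          ((1 / (n : ℝ)) * ∑ i, (x i - condMean m P (X i) ω)) := by
  have hg := @measurable_standardizedSum Ω m n _ (measurable_avgCondVar (m := m) (P := P) X) _
    fun i ↦ measurable_condMean (m := m) (P := P) (X i)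
  -- The conditioning variable is the identity from `mΩ` to `m`; hence `g` must be measurable for
  -- `m` in its first argument.
  have h := @condDistrib_comp_prodMk Ω Ω (Fin n → ℝ) ℝ mΩ m _ _ _ _ _ _ P _ id (fun ω i ↦ X i ω)
    (measurable_id'' hm) (measurable_pi_lambda _ hX) _ hg
  filter_upwards [h, condLawPi_ae_eq_pi hm hX hindep] with ω h1 h2
  rw [← h2]
  exact h1

/-- Off one null set the conditional law is a pushforward of a product, after which the Berry–Esseen
bound is deterministic and uniform in `t`. -/
theorem sqrt_mul_condKolmogorovDist_le (hm : m ≤ mΩ) {n : ℕ} {X : Fin n → Ω → ℝ}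
    (hX : ∀ i, Measurable (X i)) (hindep : CondIndepGiven m P X) {η M : ℝ≥0} (hη : 0 < η)
    (hM : 0 < M) :
    ∀ᵐ ω ∂P, η ≤ avgCondVar m P X ω → avgCondThirdMoment m P X ω ≤ M →
      ENNReal.ofReal √(n : ℝ) * condKolmogorovDist m P (condStdSum m P X) ω ≤
        ENNReal.ofReal (58 * (M / √(η : ℝ) ^ 3)) := by
  filter_upwards [condLaw_condStdSum_ae_eq hm hX hindep] with ω hω hV hT
  have hbound : condKolmogorovDist m P (condStdSum m P X) ω ≤
      ENNReal.ofReal (58 * (M / (√(n : ℝ) * √(η : ℝ) ^ 3))) := by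
    refine iSup_le fun t ↦ ?_
    rw [← ofReal_norm, Real.norm_eq_abs, hω]
    exact ENNReal.ofReal_le_ofReal (abs_map_pi_Iic_sub_cdf_le
      (fun i ↦ condLaw m P (X i) ω) hη hM rfl hV hT t)
  calc _ ≤ ENNReal.ofReal √(n : ℝ) * ENNReal.ofReal (58 * (M / (√(n : ℝ) * √(η : ℝ) ^ 3))) := by
        gcongr
    _ = ENNReal.ofReal (√(n : ℝ) * (58 * (M / (√(n : ℝ) * √(η : ℝ) ^ 3)))) :=
        (ENNReal.ofReal_mul (by positivity)).symm
    _ ≤ _ := by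
        refine ENNReal.ofReal_le_ofReal ?_
        rcases eq_or_lt_of_le (Real.sqrt_nonneg (n : ℝ)) with h | h
        · rw [← h, zero_mul]; positivity
        · refine le_of_eq ?_
          have : 0 < √(η : ℝ) := Real.sqrt_pos.2 hη
          field_simp

end ConditionalLaw

/-! ### Conclusion by a union bound -/

theorem mainTheorem3 {Ω : Type*} [mΩ : MeasurableSpace Ω]
    (P : ℕ → Measure Ω) [∀ n, IsProbabilityMeasure (P n)]
    (ℱ : ℕ → MeasurableSpace Ω) (hℱ : ∀ n, ℱ n ≤ mΩ)
    (W : (n : ℕ) → Fin n → Ω → ℝ) (hW : ∀ n i, Measurable (W n i))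
    (hindep : ∀ n, CondIndepGiven (ℱ n) (P n) (W n))
    (hvar : IsBigOmegaInProb P fun n ↦ avgCondVar (ℱ n) (P n) (W n))
    (hthird : IsBigOInProb P fun n ↦ avgCondThirdMoment (ℱ n) (P n) (W n)) :
    IsBigOInProb P fun n ω ↦ ENNReal.ofReal √(n : ℝ) *
      condKolmogorovDist (ℱ n) (P n) (condStdSum (ℱ n) (P n) (W n)) ω := by
  intro δ hδ
  have hδ2 : 0 < δ / 2 := ENNReal.half_pos hδ.ne'
  obtain ⟨η, hη, hlimη⟩ := hvar (δ / 2) hδ2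
  obtain ⟨M, hM, hlimM⟩ := hthird (δ / 2) hδ2
  -- Levels strictly below `δ / 2` keep the final limsup strictly below `δ`.
  obtain ⟨a, ha1, ha2⟩ := exists_between hlimη
  obtain ⟨b, hb1, hb2⟩ := exists_between hlimM
  have hK : 0 < 58 * ((M : ℝ) / √(η : ℝ) ^ 3) :=
    mul_pos (by norm_num) (div_pos hM (pow_pos (Real.sqrt_pos.2 hη) 3))
  refine ⟨(58 * ((M : ℝ) / √(η : ℝ) ^ 3)).toNNReal, Real.toNNReal_pos.2 hK, ?_⟩
  refine lt_of_le_of_lt ?_ ((ENNReal.add_lt_add ha2 hb2).trans_eq (ENNReal.add_halves δ))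
  refine limsup_le_of_le (by isBoundedDefault) ?_
  filter_upwards [eventually_lt_of_limsup_lt ha1, eventually_lt_of_limsup_lt hb1] with n hna hnb
  refine le_trans ?_ (add_le_add hna.le hnb.le)
  -- Monotonicity and subadditivity hold for arbitrary sets, so measurability of the supremum over
  -- `t` plays no role.
  refine le_trans (measure_mono_ae ?_) (measure_union_le _ _)
  filter_upwards [sqrt_mul_condKolmogorovDist_le (hℱ n) (hW n) (hindep n) hη hM] with ω hω hlt
  by_contra hnot
  have h1 : ¬ avgCondVar (ℱ n) (P n) (W n) ω < η := fun h ↦ hnot (Or.inl h)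
  have h2 : ¬ (M : ℝ≥0∞) < avgCondThirdMoment (ℱ n) (P n) (W n) ω := fun h ↦ hnot (Or.inr h)
  exact absurd (hω (not_lt.1 h1) (not_lt.1 h2)) (not_le.2 hlt)
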